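/- Throughout, a lattice is a free $\mathbb{Z}$-module of finite rank; for a lattice $N$ put $N_{\mathbb{R}} := \mathbb{R}\otimes_{\mathbb{Z}} N$, and for a homomorphism $F$ of lattices let $F_{\mathbb{R}}$ be its real extension. A cone in $N$ is a (not necessarily strictly) convex rational polyhedral cone in $N_{\mathbb{R}}$; $\sigma^\circ$ is the relative interior of $\sigma$, $\tau\prec\sigma$ means that $\tau$ is a face of $\sigma$, and $A^{\max}$ is the set of $\prec$-maximal elements of a set $A$ of cones. A quasi-fan in $N$ is a finite nonempty set of cones in $N$ which contains all faces of its elements and any two elements of which intersect in a common face. A system of quasi-fans in $N$ is a family $\mathcal{S}=(\Sigma_{ij})_{i,j\in I}$ of quasi-fans in $N$, $I$ finite, with $\Sigma_{ij}=\Sigma_{ji}$ and $\Sigma_{ij}\cap\Sigma_{jk}\subset\Sigma_{ik}$ for all $i,j,k$; it is affine if each $\Sigma_{ii}$ is the set of faces of a single cone $\sigma(i)$. Let $\Omega(\mathcal{S})$ be the set of classes $[\sigma,i]$ of pairs $(\sigma,i)$, $\sigma\in\Sigma_{ii}$, where $(\sigma,i)\sim(\sigma,j)$ iff $\sigma\in\Sigma_{ij}$,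 ordered by $[\tau,j]\prec[\sigma,i]$ iff $\tau\prec\sigma$ and $[\tau,i]=[\tau,j]$. A map $\mathcal{S}\to\mathcal{S}'$ of systems of quasi-fans in $N$, $N'$ is a pair $(F,\mathfrak{f})$ of a lattice homomorphism $F\colon N\to N'$ and an order-preserving map $\mathfrak{f}\colon\Omega(\mathcal{S})\to\Omega(\mathcal{S}')$ such that $\mathfrak{f}([\sigma,i])=[\sigma',i']$ implies $F_{\mathbb{R}}(\sigma^\circ)\subset(\sigma')^\circ$. For a primitive sublattice $L\subset N$ (i.e. $N/L$ is torsion free), a prequotient for an affine system $\mathcal{S}$ by $L$ is a map $(P,\mathfrak{p})$ from $\mathcal{S}$ to an affine system $\widetilde{\mathcal{S}}$ of quasi-fans in a lattice $\widetilde N$ such that $L\subset\ker P$ and every map $(F,\mathfrak{f})$ from $\mathcal{S}$ to an affine system $\mathcal{S}'$ of quasi-fans with $F|_L=0$ can be written as $(F,\mathfrak{f})=(\widetilde F,\widetilde{\mathfrak{f}})\circ(P,\mathfrak{p})$ with a unique map $(\widetilde F,\widetilde{\mathfrak{f}})\colon\widetilde{\mathcal{S}}\to\mathcal{S}'$. Theorem.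 Let $\mathcal{S}=(\Sigma_{ij})_{i,j\in I}$ be an affine system of quasi-fans in a lattice $N$, with maximal cones $\sigma(i)$, and let $L\subset N$ be a primitive sublattice. Consider the following procedure. Initialization: let $P\colon N\to N/L$ be the projection, put $\tau(i):=P_{\mathbb{R}}(\sigma(i))$ for $i\in I$, and let $S_{ij}$ be the set of all faces of the cones $P_{\mathbb{R}}(\varrho)$, $\varrho\in\Sigma_{ij}^{\max}$. Loop 1: while there are $i,j\in I$ and $\varrho\in S_{ij}^{\max}$ with $\varrho\not\prec\tau(i)$, choose such $i,j,\varrho$ and let $\varrho_i$ be the face of $\tau(i)$ with $\varrho^\circ\subset\varrho_i^\circ$; replace $\tau(j)$ by $\mathrm{conv}(\tau(j)\cup\varrho_i)$ and $S_{jj}$ by the set of faces of the new $\tau(j)$; remove all faces of $\varrho$ from $S_{ij}$ and $S_{ji}$ and add instead all faces of $\varrho_i$. Loop 2: while there are $i,j,k\in I$ and $\varrho\in S_{ij}\cap S_{jk}$ with $\varrho\notin S_{ik}$, choose such $i,j,k,\varrho$ and replace $S_{ik}$ and $S_{ki}$ by $S_{ik}\cup\{\varrho' ;\ \varrho'\prec\varrho\}$.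 Output: the cones $\tau(i)$ and the sets $S_{ij}$. Then, for any choices made in the loops, the following holds. 1. At every stage the $\tau(i)$ are cones in the lattice $N/L$ and the $S_{ij}$ are finite sets of cones in $N/L$; and in every step of Loop 1 the face $\varrho_i$ exists and is unique. In particular, the procedure can always be continued until it yields an output. 2. The procedure terminates: there is no infinite run. 3. For every output, $\widetilde{\mathcal{S}}:=(S_{ij})_{i,j\in I}$ is an affine system of quasi-fans in $N/L$ with maximal cones $\tau(i)$; for every $\sigma\in\Sigma_{ij}$ there is a $\tau\in S_{ij}$ with $P_{\mathbb{R}}(\sigma)\subset\tau$; there is a unique map $(P,\mathfrak{p})$ of systems of quasi-fans from $\mathcal{S}$ to $\widetilde{\mathcal{S}}$ with first component $P$ such that $\mathfrak{p}([\sigma,i])\prec[\tau(i),i]$ for all $[\sigma,i]\in\Omega(\mathcal{S})$; and this map $(P,\mathfrak{p})$ is a prequotient for $\mathcal{S}$ by $L$. -/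

import Mathlib

open scoped TensorProduct

/-! ## Cones in a lattice

A lattice is a free `ℤ`-module `N` of finite rank, with real vector space `N_ℝ = ℝ ⊗[ℤ] N`;
lattice homomorphisms are additive maps. Faces are Mathlib's `PointedCone.IsFaceOf`. -/

/-- The set of faces of a cone. -/
def coneFaces {V : Type*} [AddCommGroup V] [Module ℝ V] (σ : PointedCone ℝ V) :
    Set (PointedCone ℝ V) :=
  {τ | τ.IsFaceOf σ}

/-- The relative interior of a convex cone: the points `x` of `σ` such that from every point `y` of
`σ` the segment towards `x` can be prolonged beyond `x` inside of `σ`. -/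
def coneRelInterior {V : Type*} [AddCommGroup V] [Module ℝ V] (σ : PointedCone ℝ V) : Set V :=
  {x | x ∈ σ ∧ ∀ y ∈ σ, ∃ ε : ℝ, 0 < ε ∧ x - ε • y ∈ σ}

/-- In a finite dimensional normed space, `coneRelInterior` is the topological relative interior. -/
theorem coneRelInterior_eq_intrinsicInterior {V : Type*} [NormedAddCommGroup V] [NormedSpace ℝ V]
    [FiniteDimensional ℝ V] (σ : PointedCone ℝ V) :
    coneRelInterior σ = intrinsicInterior ℝ (σ : Set V) := by
  have h0 : (0 : V) ∈ affineSpan ℝ (σ : Set V) := subset_affineSpan ℝ _ σ.zero_mem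
  ext x
  constructor
  · rintro ⟨hx, h⟩
    obtain ⟨w, hw⟩ : (intrinsicInterior ℝ (σ : Set V)).Nonempty :=
      Set.Nonempty.intrinsicInterior σ.convex ⟨0, σ.zero_mem⟩
    obtain ⟨ε, hε, hu⟩ := h w (intrinsicInterior_subset hw)
    obtain ⟨w', hw', rfl⟩ := mem_intrinsicInterior.1 hw
    have hmem : ∀ p : affineSpan ℝ (σ : Set V),
        ε⁻¹ • ((p : V) - (x - ε • (w' : V))) ∈ affineSpan ℝ (σ : Set V) := by
      intro p
      have h1 := AffineSubspace.smul_vsub_vadd_mem (affineSpan ℝ (σ : Set V)) ε⁻¹ p.2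
        (subset_affineSpan ℝ _ hu) h0
      simpa using h1
    let k : affineSpan ℝ (σ : Set V) → affineSpan ℝ (σ : Set V) := fun p => ⟨_, hmem p⟩
    have hk : Continuous k := by
      refine Continuous.subtype_mk ?_ _
      exact (continuous_subtype_val.sub continuous_const).const_smul _
    let x' : affineSpan ℝ (σ : Set V) := ⟨x, subset_affineSpan ℝ _ hx⟩
    have hkx : k x' = w' := by
      apply Subtype.ext
      simp [k, x', smul_smul, hε.ne']
    refine mem_intrinsicInterior.2 ⟨x', ?_, rfl⟩
    rw [mem_interior_iff_mem_nhds] at hw' ⊢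
    have h2 : k ⁻¹' (Subtype.val ⁻¹' (σ : Set V)) ∈ nhds x' :=
      hk.continuousAt.preimage_mem_nhds (by rw [hkx]; exact hw')
    filter_upwards [h2] with p hp
    have h3 : ε • (ε⁻¹ • ((p : V) - (x - ε • (w' : V)))) + (x - ε • (w' : V)) ∈ σ :=
      σ.add_mem (PointedCone.smul_mem σ hε.le hp) hu
    simpa [smul_smul, hε.ne'] using h3
  · intro hx
    refine ⟨intrinsicInterior_subset hx, fun z hz => ?_⟩
    obtain ⟨x', hx', rfl⟩ := mem_intrinsicInterior.1 hx
    have hmem : ∀ t : ℝ, (1 + t) • (x' : V) - t • z ∈ affineSpan ℝ (σ : Set V) := by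
      intro t
      have h1 := AffineSubspace.smul_vsub_vadd_mem (affineSpan ℝ (σ : Set V)) t x'.2
        (subset_affineSpan ℝ _ hz) x'.2
      have h2 : t • ((x' : V) -ᵥ z) +ᵥ (x' : V) = (1 + t) • (x' : V) - t • z := by
        simp only [vsub_eq_sub, vadd_eq_add]; module
      rwa [h2] at h1
    let g : ℝ → affineSpan ℝ (σ : Set V) := fun t => ⟨_, hmem t⟩
    have hg : Continuous g := by
      refine Continuous.subtype_mk ?_ _
      fun_prop
    have hg0 : g 0 = x' := by
      apply Subtype.ext
      simp [g]
    have h2 : g ⁻¹' (Subtype.val ⁻¹' (σ : Set V)) ∈ nhds (0 : ℝ) :=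
      hg.continuousAt.preimage_mem_nhds
        (by rw [hg0]; exact mem_interior_iff_mem_nhds.1 hx')
    obtain ⟨δ, hδ, hball⟩ := Metric.mem_nhds_iff.1 h2
    have h3 : (1 + δ / 2) • (x' : V) - (δ / 2) • z ∈ σ := by
      have : δ / 2 ∈ Metric.ball (0 : ℝ) δ := by
        rw [Metric.mem_ball, Real.dist_eq, sub_zero, abs_of_pos (by positivity)]; linarith
      exact hball this
    refine ⟨(1 + δ / 2)⁻¹ * (δ / 2), by positivity, ?_⟩
    have h4 := PointedCone.smul_mem σ (r := (1 + δ / 2)⁻¹) (by positivity) h3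
    have h5 : (1 + δ / 2) ≠ 0 := by positivity
    rwa [smul_sub, smul_smul, smul_smul, inv_mul_cancel₀ h5, one_smul] at h4

/-- `σ` is a (rational polyhedral) cone in the lattice `N`: it is generated by finitely many
lattice vectors. -/
def IsLatticeCone {N : Type*} [AddCommGroup N] (σ : PointedCone ℝ (ℝ ⊗[ℤ] N)) : Prop :=
  ∃ s : Set N, s.Finite ∧ σ = PointedCone.hull ℝ ((fun n : N => (1 : ℝ) ⊗ₜ[ℤ] n) '' s)

/-- The extension `F_ℝ : N_ℝ → N'_ℝ` of a lattice homomorphism `F`. -/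
noncomputable def realExt {N N' : Type*} [AddCommGroup N] [AddCommGroup N'] (F : N →+ N') :
    (ℝ ⊗[ℤ] N) →ₗ[ℝ] (ℝ ⊗[ℤ] N') :=
  F.toIntLinearMap.baseChange ℝ

/-- The maximal elements of a set of cones with respect to the face relation. -/
def maxCones {V : Type*} [AddCommGroup V] [Module ℝ V] (A : Set (PointedCone ℝ V)) :
    Set (PointedCone ℝ V) :=
  {ρ | ρ ∈ A ∧ ∀ ρ' ∈ A, ρ.IsFaceOf ρ' → ρ' = ρ}

/-! ## Systems of quasi-fans -/

/-- A quasi-fan in the lattice `N`: a finite nonempty set of cones in `N`, closed under taking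
faces, such that any two of its cones intersect in a common face. -/
structure IsQuasiFan {N : Type*} [AddCommGroup N] (A : Set (PointedCone ℝ (ℝ ⊗[ℤ] N))) : Prop where
  finite : A.Finite
  nonempty : A.Nonempty
  isLatticeCone : ∀ σ ∈ A, IsLatticeCone σ
  face_mem : ∀ σ ∈ A, ∀ τ : PointedCone ℝ (ℝ ⊗[ℤ] N), τ.IsFaceOf σ → τ ∈ A
  inf_isFaceOf : ∀ σ ∈ A, ∀ τ ∈ A, (σ ⊓ τ).IsFaceOf σ ∧ (σ ⊓ τ).IsFaceOf τ

/-- A system of quasi-fans in `N` with index set `I` (which is finite in all uses). The third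
condition says that the quasi-fan `Σ_ij ∩ Σ_jk` is a sub-quasi-fan of `Σ_ik`. -/
structure QuasiFanSystem (N : Type*) [AddCommGroup N] (I : Type*) where
  fan : I → I → Set (PointedCone ℝ (ℝ ⊗[ℤ] N))
  isQuasiFan : ∀ i j, IsQuasiFan (fan i j)
  symm : ∀ i j, fan i j = fan j i
  trans : ∀ i j k, fan i j ∩ fan j k ⊆ fan i k

/-- An affine system of quasi-fans: `Σ_ii` consists of the faces of a single cone `σ(i)`. -/
structure AffineQuasiFanSystem (N : Type*) [AddCommGroup N] (I : Type*) extends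
    QuasiFanSystem N I where
  cone : I → PointedCone ℝ (ℝ ⊗[ℤ] N)
  fan_self : ∀ i, fan i i = coneFaces (cone i)

namespace QuasiFanSystem

variable {N : Type*} [AddCommGroup N] {I : Type*} (S : QuasiFanSystem N I)

theorem fan_subset_left (i j : I) : S.fan i j ⊆ S.fan i i := fun σ h =>
  S.trans i j i ⟨h, by rw [S.symm]; exact h⟩

theorem fan_subset_right (i j : I) : S.fan i j ⊆ S.fan j j := by
  rw [S.symm i j]; exact S.fan_subset_left j i

/-- The labelled cones `(σ, i)` with `σ ∈ Σ_ii`. -/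
structure Labelled where
  cone : PointedCone ℝ (ℝ ⊗[ℤ] N)
  idx : I
  mem : cone ∈ S.fan idx idx

/-- The glueing relation: `(σ, i) ∼ (σ, j)` if and only if `σ ∈ Σ_ij`. -/
instance glueing : Setoid S.Labelled where
  r p q := p.cone = q.cone ∧ p.cone ∈ S.fan p.idx q.idx
  iseqv :=
    { refl := fun p => ⟨rfl, p.mem⟩
      symm := fun {p q} h => ⟨h.1.symm, by rw [← h.1, S.symm]; exact h.2⟩
      trans := fun {p q r} h h' =>
        ⟨h.1.trans h'.1, S.trans p.idx q.idx r.idx ⟨h.2, by rw [h.1]; exact h'.2⟩⟩ }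

/-- The set `Ω(S)` of equivalence classes of labelled cones. -/
def Classes : Type _ := Quotient S.glueing

/-- The class `[σ, i]`. -/
def mkClass (i : I) (σ : PointedCone ℝ (ℝ ⊗[ℤ] N)) (h : σ ∈ S.fan i i) : S.Classes :=
  Quotient.mk S.glueing ⟨σ, i, h⟩

variable {S} in
theorem mkClass_eq_iff {i j : I} {σ τ : PointedCone ℝ (ℝ ⊗[ℤ] N)} {hσ : σ ∈ S.fan i i}
    {hτ : τ ∈ S.fan j j} :
    S.mkClass i σ hσ = S.mkClass j τ hτ ↔ σ = τ ∧ σ ∈ S.fan i j :=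
  Quotient.eq (r := S.glueing)

variable {S} in
theorem exists_mkClass (a : S.Classes) : ∃ i σ h, S.mkClass i σ h = a := by
  obtain ⟨⟨σ, i, h⟩, rfl⟩ := Quotient.exists_rep a
  exact ⟨i, σ, h, rfl⟩

/-- `[τ, j] ≺ [σ, i]` if `τ` is a face of `σ` and `[τ, i] = [τ, j]`, that is `τ ∈ Σ_ij`. -/
instance : PartialOrder S.Classes where
  le a b := ∃ (j : I) (τ : PointedCone ℝ (ℝ ⊗[ℤ] N)) (hτ : τ ∈ S.fan j j)
    (i : I) (σ : PointedCone ℝ (ℝ ⊗[ℤ] N)) (hσ : σ ∈ S.fan i i),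
    S.mkClass j τ hτ = a ∧ S.mkClass i σ hσ = b ∧ τ.IsFaceOf σ ∧ τ ∈ S.fan i j
  le_refl a := by
    obtain ⟨i, σ, h, rfl⟩ := exists_mkClass a
    exact ⟨i, σ, h, i, σ, h, rfl, rfl, .refl _, h⟩
  le_trans a b c := by
    rintro ⟨j, τ, hτ, i, σ, hσ, rfl, rfl, hf, hm⟩ ⟨i', σ', hσ', k, ρ, hρ, h, rfl, hf', hm'⟩
    obtain ⟨rfl, hi⟩ := mkClass_eq_iff.1 h
    have h1 : τ ∈ S.fan k i' := (S.isQuasiFan k i').face_mem _ hm' _ hf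
    have h2 : τ ∈ S.fan i' i := (S.isQuasiFan i' i).face_mem _ hi _ hf
    exact ⟨j, τ, hτ, k, ρ, hρ, rfl, rfl, hf.trans hf',
      S.trans k i j ⟨S.trans k i' i ⟨h1, h2⟩, hm⟩⟩
  le_antisymm a b := by
    rintro ⟨j, τ, hτ, i, σ, hσ, rfl, rfl, hf, hm⟩ ⟨i', σ', hσ', j', τ', hτ', h, h', hf', -⟩
    obtain ⟨rfl, -⟩ := mkClass_eq_iff.1 h
    obtain ⟨rfl, -⟩ := mkClass_eq_iff.1 h'
    have : τ' = σ' := le_antisymm hf.le hf'.le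
    subst this
    exact mkClass_eq_iff.2 ⟨rfl, by rw [S.symm]; exact hm⟩

end QuasiFanSystem

/-- A map `(F, 𝔣)` of systems of quasi-fans. -/
@[ext]
structure QuasiFanMap {N I N' I' : Type*} [AddCommGroup N] [AddCommGroup N']
    (S : QuasiFanSystem N I) (S' : QuasiFanSystem N' I') where
  hom : N →+ N'
  onClasses : S.Classes → S'.Classes
  mono : ∀ a b : S.Classes, a ≤ b → onClasses a ≤ onClasses b
  image_relInterior : ∀ (i : I) (σ : PointedCone ℝ (ℝ ⊗[ℤ] N)) (hσ : σ ∈ S.fan i i)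
    (i' : I') (σ' : PointedCone ℝ (ℝ ⊗[ℤ] N')) (hσ' : σ' ∈ S'.fan i' i'),
    onClasses (S.mkClass i σ hσ) = S'.mkClass i' σ' hσ' →
      realExt hom '' coneRelInterior σ ⊆ coneRelInterior σ'

/-- Composition of maps of systems of quasi-fans: `(G, 𝔤) ∘ (F, 𝔣) = (G ∘ F, 𝔤 ∘ 𝔣)`. -/
def QuasiFanMap.comp {N I N' I' N'' I'' : Type*} [AddCommGroup N] [AddCommGroup N']
    [AddCommGroup N''] {S : QuasiFanSystem N I} {S' : QuasiFanSystem N' I'}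
    {S'' : QuasiFanSystem N'' I''} (g : QuasiFanMap S' S'') (f : QuasiFanMap S S') :
    QuasiFanMap S S'' where
  hom := g.hom.comp f.hom
  onClasses := g.onClasses ∘ f.onClasses
  mono a b h := g.mono _ _ (f.mono _ _ h)
  image_relInterior i σ hσ i'' σ'' hσ'' h := by
    obtain ⟨i', σ', hσ', h'⟩ := QuasiFanSystem.exists_mkClass (f.onClasses (S.mkClass i σ hσ))
    have h1 := f.image_relInterior i σ hσ i' σ' hσ' h'.symm
    have h2 := g.image_relInterior i' σ' hσ' i'' σ'' hσ'' (by rw [h']; exact h)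
    rintro _ ⟨x, hx, rfl⟩
    have h3 := h2 ⟨_, h1 ⟨x, hx, rfl⟩, rfl⟩
    have h4 : realExt (g.hom.comp f.hom) x = realExt g.hom (realExt f.hom x) := by
      have : (g.hom.comp f.hom).toIntLinearMap =
          g.hom.toIntLinearMap.comp f.hom.toIntLinearMap := rfl
      simp only [realExt, this, LinearMap.baseChange_comp, LinearMap.comp_apply]
    rw [h4]; exact h3

/-- The map `(P, 𝔭)` from `S` to `T` is a prequotient for `S` by the sublattice `L`: `T` is an
affine system of quasi-fans in a lattice, `L ⊆ ker P`, and every map from `S` to an affine system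
of quasi-fans whose lattice homomorphism vanishes on `L` factors uniquely through `(P, 𝔭)`.
The universe levels `w, w'` of the test lattices and index sets are arbitrary. -/
structure IsPrequotient.{w, w', u, v, u', v'} {N : Type u} {I : Type v} [AddCommGroup N]
    {N' : Type u'} {I' : Type v'} [AddCommGroup N'] {S : AffineQuasiFanSystem N I}
    (L : AddSubgroup N) {T : AffineQuasiFanSystem N' I'}
    (p : QuasiFanMap S.toQuasiFanSystem T.toQuasiFanSystem) : Prop where
  free : Module.Free ℤ N'
  finite : Module.Finite ℤ N'
  finite_idx : Finite I'
  le_ker : L ≤ p.hom.ker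
  universal : ∀ (M : Type w) (J : Type w') [AddCommGroup M] [Module.Free ℤ M] [Module.Finite ℤ M]
    [Finite J] (R : AffineQuasiFanSystem M J)
    (f : QuasiFanMap S.toQuasiFanSystem R.toQuasiFanSystem), (∀ x ∈ L, f.hom x = 0) →
      ∃! g : QuasiFanMap T.toQuasiFanSystem R.toQuasiFanSystem, f = g.comp p

/-! ## The algorithm -/

/-- The data the algorithm works on: cones `τ(i)` and sets of cones `S_ij`. -/
structure ConeData (M : Type*) [AddCommGroup M] (I : Type*) where
  tau : I → PointedCone ℝ (ℝ ⊗[ℤ] M)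
  cones : I → I → Set (PointedCone ℝ (ℝ ⊗[ℤ] M))

namespace ConeData

variable {M : Type*} [AddCommGroup M] {I : Type*}

/-- Initialization: `τ(i)` is the image of `σ(i)` in `(N ⧸ L)_ℝ`, and `S_ij` consists of the faces
of the images of the maximal cones of `Σ_ij`. -/
noncomputable def init {N : Type*} [AddCommGroup N] {I : Type*} (S : AffineQuasiFanSystem N I)
    (L : AddSubgroup N) : ConeData (N ⧸ L) I where
  tau i := (S.cone i).map (realExt (QuotientAddGroup.mk' L))
  cones i j := {τ | ∃ ρ ∈ maxCones (S.fan i j), τ.IsFaceOf (ρ.map (realExt (QuotientAddGroup.mk' L)))}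

/-- The condition under which Loop 1 is continued at `i`, `j`, `ρ`. -/
def Violates (s : ConeData M I) (i j : I) (ρ : PointedCone ℝ (ℝ ⊗[ℤ] M)) : Prop :=
  ρ ∈ maxCones (s.cones i j) ∧ ¬ ρ.IsFaceOf (s.tau i)

/-- `κ` is the face of `τ(i)` whose relative interior contains that of `ρ`. -/
def IsEnvelopingFace (s : ConeData M I) (i : I) (ρ κ : PointedCone ℝ (ℝ ⊗[ℤ] M)) : Prop :=
  κ.IsFaceOf (s.tau i) ∧ coneRelInterior ρ ⊆ coneRelInterior κ

open Classical in
/-- The update made in Loop 1: `τ(j)` is replaced by the convex hull of `τ(j) ∪ κ` (which for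
convex cones is the cone `τ(j) ⊔ κ` spanned by both), `S_jj` by the set of its faces, and in `S_ij`
and `S_ji` the faces of `ρ` are removed and those of `κ` are added. -/
noncomputable def enlarge (s : ConeData M I) (i j : I) (ρ κ : PointedCone ℝ (ℝ ⊗[ℤ] M)) :
    ConeData M I where
  tau a := if a = j then s.tau j ⊔ κ else s.tau a
  cones a b :=
    if a = j ∧ b = j then coneFaces (s.tau j ⊔ κ)
    else if (a = i ∧ b = j) ∨ (a = j ∧ b = i) then (s.cones a b \ coneFaces ρ) ∪ coneFaces κ
    else s.cones a b

/-- The condition under which Loop 2 is continued at `i`, `j`, `k`, `ρ`. -/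
def NotTransitive (s : ConeData M I) (i j k : I) (ρ : PointedCone ℝ (ℝ ⊗[ℤ] M)) : Prop :=
  ρ ∈ s.cones i j ∩ s.cones j k ∧ ρ ∉ s.cones i k

open Classical in
/-- The update made in Loop 2: `S_ik` and `S_ki` are replaced by the union of `S_ik` and the set of
faces of `ρ`. -/
noncomputable def glue (s : ConeData M I) (i k : I) (ρ : PointedCone ℝ (ℝ ⊗[ℤ] M)) :
    ConeData M I where
  tau := s.tau
  cones a b :=
    if (a = i ∧ b = k) ∨ (a = k ∧ b = i) then s.cones i k ∪ coneFaces ρ else s.cones a b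

end ConeData

/-- A configuration of the algorithm: it is in Loop 1, in Loop 2, or it has halted with an
output. -/
inductive AlgConfig (M : Type*) [AddCommGroup M] (I : Type*)
  | loop1 (s : ConeData M I)
  | loop2 (s : ConeData M I)
  | output (s : ConeData M I)

/-- The data of a configuration. -/
def AlgConfig.data {M : Type*} [AddCommGroup M] {I : Type*} : AlgConfig M I → ConeData M I
  | .loop1 s => s
  | .loop2 s => s
  | .output s => s

/-- One step of the algorithm. It is nondeterministic: the violations are treated in an arbitrary
order. Each loop is left as soon as, and only if, its continuation condition fails. -/
inductive AlgStep {M : Type*} [AddCommGroup M] {I : Type*} : AlgConfig M I → AlgConfig M I → Prop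
  | enlarge (s : ConeData M I) (i j : I) (ρ κ : PointedCone ℝ (ℝ ⊗[ℤ] M))
      (h : s.Violates i j ρ) (hκ : s.IsEnvelopingFace i ρ κ) :
      AlgStep (.loop1 s) (.loop1 (s.enlarge i j ρ κ))
  | leave1 (s : ConeData M I) (h : ∀ i j ρ, ¬ s.Violates i j ρ) :
      AlgStep (.loop1 s) (.loop2 s)
  | glue (s : ConeData M I) (i j k : I) (ρ : PointedCone ℝ (ℝ ⊗[ℤ] M))
      (h : s.NotTransitive i j k ρ) :
      AlgStep (.loop2 s) (.loop2 (s.glue i k ρ))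
  | leave2 (s : ConeData M I) (h : ∀ i j k ρ, ¬ s.NotTransitive i j k ρ) :
      AlgStep (.loop2 s) (.output s)

/-- The configuration `c` occurs in a run of the algorithm for `S` and `L`. -/
def AlgReaches {N : Type*} [AddCommGroup N] {I : Type*} (S : AffineQuasiFanSystem N I)
    (L : AddSubgroup N) (c : AlgConfig (N ⧸ L) I) : Prop :=
  Relation.ReflTransGen AlgStep (.loop1 (ConeData.init S L)) c

/-- `(P, 𝔭)` is a map from `S` to `T` whose lattice homomorphism is the projection `P : N → N ⧸ L`
and which satisfies `𝔭([σ, i]) ≺ [τ(i), i]` for all `[σ, i] ∈ Ω(S)`, where `τ(i)` is the maximal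
cone of the affine system `T` belonging to `i`. -/
def IsIndexProjection {N : Type*} [AddCommGroup N] {I : Type*} {S : AffineQuasiFanSystem N I}
    {L : AddSubgroup N} {T : AffineQuasiFanSystem (N ⧸ L) I}
    (p : QuasiFanMap S.toQuasiFanSystem T.toQuasiFanSystem) : Prop :=
  p.hom = QuotientAddGroup.mk' L ∧
    ∀ (i : I) (σ : PointedCone ℝ (ℝ ⊗[ℤ] N)) (hσ : σ ∈ S.fan i i),
      p.onClasses (S.mkClass i σ hσ) ≤
        T.mkClass i (T.cone i) (by rw [T.fan_self]; exact PointedCone.IsFaceOf.refl _)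

universe u v w w'

/-! Finiteness. Choose finitely many lattice vectors generating all σ(i), and let G be their image
in the real space of N/L. Faces and joins of cones generated by subsets of G are again of this form
(`PointedCone.IsFaceOf.eq_hull`, `IsGeneratedIn.sup`), so only finitely many cones can ever occur.
Counting elements of G outside of cones gives a measure that drops in Loop 1
(`ConeData.IsAdmissible.weight_enlarge_lt`); counting the cones absent from the S_ij gives one for
Loop 2.

Structure. When Loop 1 stops, every cone of S_ij is a face of τ(i) and, by symmetry, of τ(j). Hence
intersections are common faces and closure under faces holds; Loop 2 only adds transitivity.

Universality. A face is determined by one point of its relative interior. So a map of systems is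
determined by its homomorphism once upper bounds for its values are prescribed
(`QuasiFanMap.eq_of_le`), and a homomorphism extends to a map as soon as it is adapted
(`IsAdapted.exists_map`). If a map from the given system vanishes on L, the induced homomorphism on
N/L is adapted to the initial data, and every update preserves this because all enlargements are
forced (`IsAdapted.enlarge`, `IsAdapted.glue`). The factorization is unique since the image of the
relative interior of σ(i) stays inside that of τ(i): thus 𝔭 hits the top class [τ(i), i]. -/

/-! ### Faces and relative interiors of convex cones. -/

section Cones

variable {V W : Type*} [AddCommGroup V] [Module ℝ V] [AddCommGroup W] [Module ℝ W]

/-- For y in ρ the point x is a sum of a positive multiple of y and another element of ρ, and a face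
contains the summands of its points. -/
theorem PointedCone.IsFaceOf.le_of_mem_coneRelInterior {σ ρ κ : PointedCone ℝ V}
    (hκ : κ.IsFaceOf σ) (hρ : ρ ≤ σ) {x : V} (hx : x ∈ coneRelInterior ρ) (hxκ : x ∈ κ) :
    ρ ≤ κ := by
  intro y hy
  obtain ⟨ε, hε, h⟩ := hx.2 y hy
  refine hκ.mem_of_smul_add_mem (hρ hy) (hρ h) hε ?_
  simpa using hxκ

theorem PointedCone.IsFaceOf.eq_of_mem_coneRelInterior {σ κ κ' : PointedCone ℝ V}
    (hκ : κ.IsFaceOf σ) (hκ' : κ'.IsFaceOf σ) {x : V} (hx : x ∈ coneRelInterior κ)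
    (hx' : x ∈ coneRelInterior κ') : κ = κ' :=
  le_antisymm (hκ'.le_of_mem_coneRelInterior hκ.le hx hx'.1)
    (hκ.le_of_mem_coneRelInterior hκ'.le hx' hx.1)

/-- A single point suffices: every relative interior point z of ρ is a positive multiple of x plus
an element of ρ, so f z is an interior point of κ plus an element of κ. -/
theorem image_coneRelInterior_subset {ρ : PointedCone ℝ V} {κ : PointedCone ℝ W} {f : V →ₗ[ℝ] W}
    (h : ρ ≤ κ.comap f) {x : V} (hx : x ∈ ρ) (hfx : f x ∈ coneRelInterior κ) :
    f '' coneRelInterior ρ ⊆ coneRelInterior κ := by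
  rintro _ ⟨z, hz, rfl⟩
  refine ⟨h hz.1, fun y hy => ?_⟩
  obtain ⟨ε, hε, h1⟩ := hfx.2 y hy
  obtain ⟨δ, hδ, h2⟩ := hz.2 x hx
  refine ⟨δ * ε, mul_pos hδ hε, ?_⟩
  have h3 : f z - (δ * ε) • y = f (z - δ • x) + δ • (f x - ε • y) := by
    simp only [map_sub, map_smul]; module
  rw [h3]
  exact κ.add_mem (h h2) (κ.smul_mem hδ.le h1)

theorem coneRelInterior_subset {ρ κ : PointedCone ℝ V} (h : ρ ≤ κ) {x : V} (hx : x ∈ ρ)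
    (hx' : x ∈ coneRelInterior κ) : coneRelInterior ρ ⊆ coneRelInterior κ := by
  simpa using image_coneRelInterior_subset (f := LinearMap.id) (κ := κ) h hx hx'

/-- Every point of a cone lies in the relative interior of a face. -/
theorem exists_face_mem_coneRelInterior {σ : PointedCone ℝ V} {x : V} (hx : x ∈ σ) :
    ∃ κ : PointedCone ℝ V, κ.IsFaceOf σ ∧ x ∈ coneRelInterior κ := by
  -- This is the smallest face containing x: the elements of σ of which a positive multiple can be
  -- subtracted from x.
  let κ : PointedCone ℝ V :=
    { carrier := {y | y ∈ σ ∧ ∃ ε : ℝ, 0 < ε ∧ x - ε • y ∈ σ}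
      zero_mem' := ⟨σ.zero_mem, 1, one_pos, by simpa using hx⟩
      add_mem' := by
        rintro y z ⟨hy, ε, hε, h1⟩ ⟨hz, δ, hδ, h2⟩
        refine ⟨σ.add_mem hy hz, ε * δ / (ε + δ), by positivity, ?_⟩
        have h3 : x - (ε * δ / (ε + δ)) • (y + z) =
            (δ / (ε + δ)) • (x - ε • y) + (ε / (ε + δ)) • (x - δ • z) := by
          have : x = (δ / (ε + δ)) • x + (ε / (ε + δ)) • x := by
            rw [← add_smul, ← add_div, add_comm δ, div_self (by positivity), one_smul]
          nth_rw 1 [this]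
          module
        rw [h3]
        exact σ.add_mem (σ.smul_mem (by positivity) h1) (σ.smul_mem (by positivity) h2)
      smul_mem' := by
        rintro ⟨c, hc⟩ y ⟨hy, ε, hε, h1⟩
        -- Dividing by c + 1 instead of c also covers c = 0.
        refine ⟨σ.smul_mem hc hy, ε / (c + 1), by positivity, ?_⟩
        have h3 : x - (ε / (c + 1)) • (c • y) =
            (c / (c + 1)) • (x - ε • y) + (1 / (c + 1)) • x := by
          have : x = (c / (c + 1)) • x + (1 / (c + 1)) • x := by
            rw [← add_smul, ← add_div, div_self (by positivity), one_smul]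
          nth_rw 1 [this]
          module
        change x - (ε / (c + 1)) • (c • y) ∈ σ
        rw [h3]
        exact σ.add_mem (σ.smul_mem (by positivity) h1) (σ.smul_mem (by positivity) hx) }
  refine ⟨κ, ⟨fun y hy => hy.1, ?_⟩, ⟨hx, 1, one_pos, by simp⟩, ?_⟩
  · rintro y z a hy hz ha ⟨-, ε, hε, h⟩
    refine ⟨hy, ε * a, mul_pos hε ha, ?_⟩
    have h1 : x - (ε * a) • y = (x - ε • (a • y + z)) + ε • z := by module
    rw [h1]
    exact σ.add_mem h (σ.smul_mem hε.le hz)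
  · rintro y ⟨hy, ε, hε, h⟩
    exact ⟨ε, hε, h, 1, one_pos, by simpa using σ.smul_mem hε.le hy⟩

theorem exists_face_image_subset {ρ : PointedCone ℝ V} {σ : PointedCone ℝ W} {f : V →ₗ[ℝ] W}
    (hρ : (coneRelInterior ρ).Nonempty) (h : ρ ≤ σ.comap f) :
    ∃ κ : PointedCone ℝ W, κ.IsFaceOf σ ∧ f '' coneRelInterior ρ ⊆ coneRelInterior κ := by
  obtain ⟨x, hx⟩ := hρ
  obtain ⟨κ, hκ, hxκ⟩ := exists_face_mem_coneRelInterior (show f x ∈ σ from h hx.1)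
  exact ⟨κ, hκ, image_coneRelInterior_subset
    ((hκ.comap f).le_of_mem_coneRelInterior h hx hxκ.1) hx.1 hxκ⟩

theorem le_comap_of_image_subset {ρ : PointedCone ℝ V} {σ κ : PointedCone ℝ W} {f : V →ₗ[ℝ] W}
    (hρ : (coneRelInterior ρ).Nonempty) (h : ρ ≤ σ.comap f) (hκ : κ.IsFaceOf σ)
    (hi : f '' coneRelInterior ρ ⊆ coneRelInterior κ) : ρ ≤ κ.comap f := by
  obtain ⟨x, hx⟩ := hρ
  exact (hκ.comap f).le_of_mem_coneRelInterior h hx (hi ⟨x, hx, rfl⟩).1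

theorem eq_of_image_subset {ρ : PointedCone ℝ V} {σ κ κ' : PointedCone ℝ W} {f : V →ₗ[ℝ] W}
    (hρ : (coneRelInterior ρ).Nonempty) (hκ : κ.IsFaceOf σ) (hκ' : κ'.IsFaceOf σ)
    (hi : f '' coneRelInterior ρ ⊆ coneRelInterior κ)
    (hi' : f '' coneRelInterior ρ ⊆ coneRelInterior κ') : κ = κ' := by
  obtain ⟨x, hx⟩ := hρ
  exact hκ.eq_of_mem_coneRelInterior hκ' (hi ⟨x, hx, rfl⟩) (hi' ⟨x, hx, rfl⟩)

/-- The sum of the generators is a relative interior point: a face containing it contains each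
summand, hence is the whole cone. -/
theorem coneRelInterior_hull_nonempty {s : Set V} (hs : s.Finite) :
    (coneRelInterior (PointedCone.hull ℝ s)).Nonempty := by
  classical
  lift s to Finset V using hs
  have hmem : ∑ g ∈ s, g ∈ PointedCone.hull ℝ (s : Set V) :=
    Submodule.sum_mem _ fun g hg => PointedCone.subset_hull hg
  obtain ⟨κ, hκ, hx⟩ := exists_face_mem_coneRelInterior hmem
  have hle : PointedCone.hull ℝ (s : Set V) ≤ κ := by
    refine Submodule.span_le.2 fun g hg => ?_
    have h1 : g + ∑ g ∈ s.erase g, g ∈ κ := by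
      rw [Finset.add_sum_erase s (fun g => g) hg]; exact hx.1
    exact hκ.mem_of_add_mem_left (PointedCone.subset_hull hg)
      (Submodule.sum_mem _ fun g hg => PointedCone.subset_hull (Finset.mem_of_mem_erase hg)) h1
  exact ⟨_, le_antisymm hle hκ.le ▸ hx⟩

/-- A face contains the summands of its points, so the generators occurring with positive
coefficient in a point of τ lie in τ. -/
theorem PointedCone.IsFaceOf.eq_hull {s : Set V} {τ : PointedCone ℝ V}
    (h : τ.IsFaceOf (PointedCone.hull ℝ s)) : τ = PointedCone.hull ℝ (s ∩ τ) := by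
  refine le_antisymm (fun x hx => ?_) (Submodule.span_le.2 Set.inter_subset_right)
  have key : ∀ x ∈ PointedCone.hull ℝ s, x ∈ τ → x ∈ PointedCone.hull ℝ (s ∩ τ) := by
    intro x hx
    induction hx using Submodule.span_induction with
    | mem x hx => exact fun h => PointedCone.subset_hull ⟨hx, h⟩
    | zero => exact fun _ => Submodule.zero_mem _
    | add x y hx hy ihx ihy =>
      exact fun hxy => Submodule.add_mem _ (ihx (h.mem_of_add_mem_left hx hy hxy))
        (ihy (h.mem_of_add_mem_right hx hy hxy))
    | smul c x hx ih =>
      intro hcx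
      rcases c.2.eq_or_lt with hc | hc
      · have : c = 0 := Subtype.ext hc.symm
        rw [this, zero_smul]; exact Submodule.zero_mem _
      · refine Submodule.smul_mem _ _ (ih ?_)
        refine h.mem_of_smul_add_mem (y := 0) hx (Submodule.zero_mem _) hc ?_
        rw [add_zero]; exact hcx
  exact key x (h.le hx) hx

/-! ### Cones generated within a fixed set, and maximal cones. -/

/-- The cone `σ` is generated by a subset of `G`. -/
def IsGeneratedIn (G : Set V) (σ : PointedCone ℝ V) : Prop :=
  ∃ s ⊆ G, σ = PointedCone.hull ℝ s

namespace IsGeneratedIn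

variable {G : Set V} {σ τ : PointedCone ℝ V}

theorem mono {G' : Set V} (hG : G ⊆ G') (h : IsGeneratedIn G σ) : IsGeneratedIn G' σ := by
  obtain ⟨s, hs, rfl⟩ := h
  exact ⟨s, hs.trans hG, rfl⟩

theorem isFaceOf (h : IsGeneratedIn G σ) (hτ : τ.IsFaceOf σ) : IsGeneratedIn G τ := by
  obtain ⟨s, hs, rfl⟩ := h
  exact ⟨_, Set.inter_subset_left.trans hs, hτ.eq_hull⟩

theorem sup (hσ : IsGeneratedIn G σ) (hτ : IsGeneratedIn G τ) : IsGeneratedIn G (σ ⊔ τ) := by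
  obtain ⟨s, hs, rfl⟩ := hσ
  obtain ⟨t, ht, rfl⟩ := hτ
  exact ⟨s ∪ t, Set.union_subset hs ht, (Submodule.span_union s t).symm⟩

theorem map (f : V →ₗ[ℝ] W) (h : IsGeneratedIn G σ) : IsGeneratedIn (f '' G) (σ.map f) := by
  obtain ⟨s, hs, rfl⟩ := h
  exact ⟨f '' s, Set.image_mono hs, Submodule.map_span _ _⟩

theorem nonempty (hG : G.Finite) (h : IsGeneratedIn G σ) : (coneRelInterior σ).Nonempty := by
  obtain ⟨s, hs, rfl⟩ := h
  exact coneRelInterior_hull_nonempty (hG.subset hs)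

theorem exists_mem_of_not_le (hσ : IsGeneratedIn G σ) (h : ¬ σ ≤ τ) :
    ∃ g ∈ G, g ∈ σ ∧ g ∉ τ := by
  obtain ⟨s, hs, rfl⟩ := hσ
  by_contra! hc
  exact h (Submodule.span_le.2 fun g hg => hc g (hs hg) (PointedCone.subset_hull hg))

end IsGeneratedIn

theorem finite_isGeneratedIn {G : Set V} (hG : G.Finite) :
    {σ : PointedCone ℝ V | IsGeneratedIn G σ}.Finite := by
  refine (hG.finite_subsets.image (PointedCone.hull ℝ)).subset ?_
  rintro _ ⟨s, hs, rfl⟩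
  exact ⟨s, hs, rfl⟩

theorem exists_mem_maxCones {A : Set (PointedCone ℝ V)} (hA : A.Finite) {ρ : PointedCone ℝ V}
    (hρ : ρ ∈ A) : ∃ μ ∈ maxCones A, ρ.IsFaceOf μ := by
  obtain ⟨μ, -, hμ⟩ := (hA.subset (Set.sep_subset A fun μ => ρ.IsFaceOf μ)).exists_le_maximal
    ⟨hρ, PointedCone.IsFaceOf.refl ρ⟩
  refine ⟨μ, ⟨hμ.prop.1, fun ρ' h' hf => ?_⟩, hμ.prop.2⟩
  exact le_antisymm (hμ.2 ⟨h', hμ.prop.2.trans hf⟩ hf.le) hf.le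

theorem maxCones_coneFaces (σ : PointedCone ℝ V) : maxCones (coneFaces σ) = {σ} := by
  ext τ
  constructor
  · rintro ⟨h, h'⟩
    exact (h' σ (PointedCone.IsFaceOf.refl σ) h).symm
  · rintro rfl
    exact ⟨PointedCone.IsFaceOf.refl _, fun ρ h h' => le_antisymm h.le h'.le⟩

/-- Removing the faces of ρ creates no new maximal cones: a surviving cone lies below a maximal one
of A, which is not a face of ρ either and so survives too. -/
theorem maxCones_replace_subset {A : Set (PointedCone ℝ V)} (hA : A.Finite)
    (ρ κ : PointedCone ℝ V) :
    maxCones ((A \ coneFaces ρ) ∪ coneFaces κ) ⊆ insert κ (maxCones A \ {ρ}) := by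
  rintro α ⟨h | h, hmax⟩
  · right
    obtain ⟨μ, hμ, hαμ⟩ := exists_mem_maxCones hA h.1
    have h1 : μ ∉ coneFaces ρ := fun h' => h.2 (hαμ.trans h')
    have h2 : μ = α := hmax μ (Or.inl ⟨hμ.1, h1⟩) hαμ
    subst h2
    refine ⟨hμ, ?_⟩
    rintro rfl
    exact h1 (PointedCone.IsFaceOf.refl _)
  · left
    exact (hmax κ (Or.inr (PointedCone.IsFaceOf.refl κ)) h).symm

end Cones

theorem isLatticeCone_iff {N : Type*} [AddCommGroup N] {σ : PointedCone ℝ (ℝ ⊗[ℤ] N)} :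
    IsLatticeCone σ ↔ ∃ s : Set N, s.Finite ∧
      IsGeneratedIn ((fun n : N => (1 : ℝ) ⊗ₜ[ℤ] n) '' s) σ := by
  constructor
  · rintro ⟨s, hs, rfl⟩
    exact ⟨s, hs, _, subset_rfl, rfl⟩
  · rintro ⟨s, hs, t, ht, rfl⟩
    obtain ⟨t', ht', rfl⟩ := Set.subset_image_iff.1 ht
    exact ⟨t', hs.subset ht', rfl⟩

theorem IsLatticeCone.coneRelInterior_nonempty {N : Type*} [AddCommGroup N]
    {σ : PointedCone ℝ (ℝ ⊗[ℤ] N)} (h : IsLatticeCone σ) : (coneRelInterior σ).Nonempty := by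
  obtain ⟨s, hs, h⟩ := isLatticeCone_iff.1 h
  exact h.nonempty (hs.image _)

/-! ### Invariants of the two loops. -/

namespace ConeData

variable {M : Type*} [AddCommGroup M] {I : Type*}

/-- The properties of the data which persist during Loop 1. All cones are generated by subsets of
the fixed set `G`. -/
structure IsAdmissible (G : Set (ℝ ⊗[ℤ] M)) (s : ConeData M I) : Prop where
  tau_gen : ∀ i, IsGeneratedIn G (s.tau i)
  cones_gen : ∀ i j, ∀ ρ ∈ s.cones i j, IsGeneratedIn G ρ
  nonempty : ∀ i j, (s.cones i j).Nonempty
  symm : ∀ i j, s.cones i j = s.cones j i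
  self : ∀ i, s.cones i i = coneFaces (s.tau i)
  le : ∀ i j, ∀ ρ ∈ s.cones i j, ρ ≤ s.tau i
  -- Loop 1 may destroy closure under faces, as a removed face of ρ can also be a face of a
  -- remaining cone. This weak form survives; it becomes full closure once all members are faces of
  -- τ(i), since then inclusion implies being a face.
  closed : ∀ i j, ∀ α ∈ s.cones i j, ∀ β : PointedCone ℝ (ℝ ⊗[ℤ] M), β.IsFaceOf α →
    ∃ μ ∈ s.cones i j, β ≤ μ ∧ (β.IsFaceOf μ → β ∈ s.cones i j)

/-- The properties of the data which persist during Loop 2. -/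
structure IsFaceAdmissible (G : Set (ℝ ⊗[ℤ] M)) (s : ConeData M I) : Prop extends
    IsAdmissible G s where
  isFaceOf : ∀ i j, ∀ ρ ∈ s.cones i j, ρ.IsFaceOf (s.tau i)
  face_mem : ∀ i j, ∀ α ∈ s.cones i j, ∀ β : PointedCone ℝ (ℝ ⊗[ℤ] M), β.IsFaceOf α →
    β ∈ s.cones i j

/-- The cones of `s` contain the images of the cones of `S`. -/
structure Covers {N : Type*} [AddCommGroup N] (S : AffineQuasiFanSystem N I) (P : N →+ M)
    (s : ConeData M I) : Prop where
  cover : ∀ i j, ∀ σ ∈ S.fan i j, ∃ ρ ∈ s.cones i j, σ.map (realExt P) ≤ ρ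
  relInterior : ∀ i, realExt P '' coneRelInterior (S.cone i) ⊆ coneRelInterior (s.tau i)

section

variable {G : Set (ℝ ⊗[ℤ] M)} {s : ConeData M I}

theorem IsAdmissible.finite (hs : s.IsAdmissible G) (hG : G.Finite) (i j : I) :
    (s.cones i j).Finite :=
  (finite_isGeneratedIn hG).subset fun ρ hρ => hs.cones_gen i j ρ hρ

theorem IsAdmissible.ne_of_violates (hs : s.IsAdmissible G) {i j : I}
    {ρ : PointedCone ℝ (ℝ ⊗[ℤ] M)} (h : s.Violates i j ρ) : i ≠ j := by
  rintro rfl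
  have h1 := h.1.1
  rw [hs.self] at h1
  exact h.2 h1

/-- Existence rests on ρ ≤ τ(i), which persists in Loop 1; uniqueness on the disjointness of
relative interiors of distinct faces. -/
theorem IsAdmissible.existsUnique_isEnvelopingFace (hs : s.IsAdmissible G) (hG : G.Finite)
    {i j : I} {ρ : PointedCone ℝ (ℝ ⊗[ℤ] M)} (h : ρ ∈ s.cones i j) :
    ∃! κ, s.IsEnvelopingFace i ρ κ := by
  have hne := (hs.cones_gen i j ρ h).nonempty hG
  obtain ⟨κ, hκ, hi⟩ := exists_face_image_subset (f := LinearMap.id) (σ := s.tau i) hne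
    (hs.le i j ρ h)
  refine ⟨κ, ⟨hκ, by simpa using hi⟩, fun κ' h' => ?_⟩
  exact eq_of_image_subset (f := LinearMap.id) hne h'.1 hκ (by simpa using h'.2) hi

theorem IsEnvelopingFace.le {i : I} {ρ κ : PointedCone ℝ (ℝ ⊗[ℤ] M)}
    (h : s.IsEnvelopingFace i ρ κ) (hρ : (coneRelInterior ρ).Nonempty) (hle : ρ ≤ s.tau i) :
    ρ ≤ κ :=
  le_comap_of_image_subset (f := LinearMap.id) hρ hle h.1 (by simpa using h.2)

theorem tau_le_enlarge (i j : I) (ρ κ : PointedCone ℝ (ℝ ⊗[ℤ] M)) (a : I) :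
    s.tau a ≤ (s.enlarge i j ρ κ).tau a := by
  by_cases h : a = j
  · subst h; simp [enlarge]
  · simp [enlarge, h]

theorem enlarge_tau_self (i j : I) (ρ κ : PointedCone ℝ (ℝ ⊗[ℤ] M)) :
    (s.enlarge i j ρ κ).tau j = s.tau j ⊔ κ := by
  simp [enlarge]

theorem enlarge_tau_of_ne {i j a : I} (ρ κ : PointedCone ℝ (ℝ ⊗[ℤ] M)) (h : a ≠ j) :
    (s.enlarge i j ρ κ).tau a = s.tau a := by
  simp [enlarge, h]

theorem enlarge_cones_self (i j : I) (ρ κ : PointedCone ℝ (ℝ ⊗[ℤ] M)) :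
    (s.enlarge i j ρ κ).cones j j = coneFaces (s.tau j ⊔ κ) := by
  simp [enlarge]

theorem enlarge_cones_left {i j : I} (ρ κ : PointedCone ℝ (ℝ ⊗[ℤ] M)) (h : i ≠ j) :
    (s.enlarge i j ρ κ).cones i j = (s.cones i j \ coneFaces ρ) ∪ coneFaces κ := by
  simp [enlarge, h]

theorem enlarge_cones_right {i j : I} (ρ κ : PointedCone ℝ (ℝ ⊗[ℤ] M)) (h : i ≠ j) :
    (s.enlarge i j ρ κ).cones j i = (s.cones j i \ coneFaces ρ) ∪ coneFaces κ := by
  simp [enlarge, h]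

theorem enlarge_cones_of_ne {i j a b : I} (ρ κ : PointedCone ℝ (ℝ ⊗[ℤ] M))
    (h : ¬ (a = j ∧ b = j)) (h' : ¬ ((a = i ∧ b = j) ∨ (a = j ∧ b = i))) :
    (s.enlarge i j ρ κ).cones a b = s.cones a b := by
  simp [enlarge, h, h']

/-- Case distinction for the sets of cones after an update of Loop 1. -/
theorem enlarge_cones_induction {i j : I} {ρ κ : PointedCone ℝ (ℝ ⊗[ℤ] M)} (hij : i ≠ j)
    {p : I → I → Prop} (self : p j j) (left : p i j) (right : p j i)
    (other : ∀ a b, (s.enlarge i j ρ κ).cones a b = s.cones a b → p a b) (a b : I) : p a b := by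
  by_cases h : a = j ∧ b = j
  · obtain ⟨rfl, rfl⟩ := h; exact self
  · by_cases h' : (a = i ∧ b = j) ∨ (a = j ∧ b = i)
    · rcases h' with ⟨rfl, rfl⟩ | ⟨rfl, rfl⟩
      · exact left
      · exact right
    · exact other a b (enlarge_cones_of_ne ρ κ h h')

theorem IsAdmissible.enlarge (hs : s.IsAdmissible G) (hG : G.Finite) {i j : I}
    {ρ κ : PointedCone ℝ (ℝ ⊗[ℤ] M)} (h : s.Violates i j ρ) (hκ : s.IsEnvelopingFace i ρ κ) :
    (s.enlarge i j ρ κ).IsAdmissible G := by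
  have hij := hs.ne_of_violates h
  have hρκ : ρ ≤ κ := hκ.le ((hs.cones_gen i j ρ h.1.1).nonempty hG) (hs.le i j ρ h.1.1)
  have hκG : IsGeneratedIn G κ := (hs.tau_gen i).isFaceOf hκ.1
  have hκi : κ ≤ (s.enlarge i j ρ κ).tau i := hκ.1.le.trans (tau_le_enlarge i j ρ κ i)
  have hκj : κ ≤ (s.enlarge i j ρ κ).tau j := by
    rw [enlarge_tau_self]; exact le_sup_right
  have hle : ∀ a b, ∀ α ∈ s.cones a b, α ≤ (s.enlarge i j ρ κ).tau a := fun a b α hα =>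
    (hs.le a b α hα).trans (tau_le_enlarge i j ρ κ a)
  have hclosed : ∀ a b, ∀ α ∈ (s.cones a b \ coneFaces ρ) ∪ coneFaces κ,
      ∀ β : PointedCone ℝ (ℝ ⊗[ℤ] M), β.IsFaceOf α →
      ∃ μ ∈ (s.cones a b \ coneFaces ρ) ∪ coneFaces κ, β ≤ μ ∧
        (β.IsFaceOf μ → β ∈ (s.cones a b \ coneFaces ρ) ∪ coneFaces κ) := by
    intro a b α hα β hβ
    have hκmem : κ ∈ (s.cones a b \ coneFaces ρ) ∪ coneFaces κ :=
      Or.inr (PointedCone.IsFaceOf.refl κ)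
    rcases hα with hα | hα
    · by_cases hβρ : β.IsFaceOf ρ
      · exact ⟨κ, hκmem, hβρ.le.trans hρκ, fun h' => Or.inr h'⟩
      obtain ⟨μ, hμ, hle, himp⟩ := hs.closed a b α hα.1 β hβ
      by_cases hμρ : μ.IsFaceOf ρ
      · exact ⟨κ, hκmem, hle.trans (hμρ.le.trans hρκ), fun h' => Or.inr h'⟩
      · exact ⟨μ, Or.inl ⟨hμ, hμρ⟩, hle, fun h' => Or.inl ⟨himp h', hβρ⟩⟩
    · exact ⟨κ, hκmem, (hβ.trans hα).le, fun h' => Or.inr h'⟩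
  refine ⟨fun a => ?_, ?_, ?_, ?_, fun a => ?_, ?_, ?_⟩
  · by_cases ha : a = j
    · subst ha; rw [enlarge_tau_self]; exact (hs.tau_gen a).sup hκG
    · rw [enlarge_tau_of_ne ρ κ ha]; exact hs.tau_gen a
  · refine enlarge_cones_induction (ρ := ρ) (κ := κ) (s := s) hij ?_ ?_ ?_ ?_
    · rw [enlarge_cones_self]
      exact fun α hα => ((hs.tau_gen j).sup hκG).isFaceOf hα
    · rw [enlarge_cones_left ρ κ hij]
      rintro α (hα | hα)
      exacts [hs.cones_gen i j α hα.1, hκG.isFaceOf hα]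
    · rw [enlarge_cones_right ρ κ hij]
      rintro α (hα | hα)
      exacts [hs.cones_gen j i α hα.1, hκG.isFaceOf hα]
    · intro a b hab
      rw [hab]; exact hs.cones_gen a b
  · refine enlarge_cones_induction (ρ := ρ) (κ := κ) (s := s) hij ?_ ?_ ?_ ?_
    · rw [enlarge_cones_self]; exact ⟨_, PointedCone.IsFaceOf.refl _⟩
    · rw [enlarge_cones_left ρ κ hij]; exact ⟨κ, Or.inr (PointedCone.IsFaceOf.refl κ)⟩
    · rw [enlarge_cones_right ρ κ hij]; exact ⟨κ, Or.inr (PointedCone.IsFaceOf.refl κ)⟩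
    · intro a b hab
      rw [hab]; exact hs.nonempty a b
  · intro a b
    by_cases h1 : a = j ∧ b = j
    · rw [h1.1, h1.2]
    by_cases h2 : (a = i ∧ b = j) ∨ (a = j ∧ b = i)
    · have : (s.enlarge i j ρ κ).cones i j = (s.enlarge i j ρ κ).cones j i := by
        rw [enlarge_cones_left ρ κ hij, enlarge_cones_right ρ κ hij, hs.symm i j]
      rcases h2 with ⟨rfl, rfl⟩ | ⟨rfl, rfl⟩
      exacts [this, this.symm]
    · rw [enlarge_cones_of_ne ρ κ h1 h2, enlarge_cones_of_ne ρ κ (by tauto) (by tauto), hs.symm]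
  · by_cases ha : a = j
    · subst ha; rw [enlarge_cones_self, enlarge_tau_self]
    · rw [enlarge_tau_of_ne ρ κ ha, enlarge_cones_of_ne ρ κ (by tauto) (by tauto), hs.self]
  · refine enlarge_cones_induction (ρ := ρ) (κ := κ) (s := s) hij ?_ ?_ ?_ ?_
    · rw [enlarge_cones_self, enlarge_tau_self]
      exact fun α hα => hα.le
    · rw [enlarge_cones_left ρ κ hij]
      rintro α (hα | hα)
      exacts [hle i j α hα.1, hα.le.trans hκi]
    · rw [enlarge_cones_right ρ κ hij]
      rintro α (hα | hα)
      exacts [hle j i α hα.1, hα.le.trans hκj]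
    · intro a b hab
      rw [hab]; exact hle a b
  · refine enlarge_cones_induction (ρ := ρ) (κ := κ) (s := s) hij ?_ ?_ ?_ ?_
    · rw [enlarge_cones_self]
      exact fun α hα β hβ => ⟨β, hβ.trans hα, le_rfl, fun _ => hβ.trans hα⟩
    · rw [enlarge_cones_left ρ κ hij]; exact hclosed i j
    · rw [enlarge_cones_right ρ κ hij]; exact hclosed j i
    · intro a b hab
      rw [hab]; exact hs.closed a b

theorem IsAdmissible.isFaceAdmissible (hs : s.IsAdmissible G) (hG : G.Finite)
    (h : ∀ i j ρ, ¬ s.Violates i j ρ) : s.IsFaceAdmissible G := by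
  have hface : ∀ i j, ∀ ρ ∈ s.cones i j, ρ.IsFaceOf (s.tau i) := by
    intro i j ρ hρ
    obtain ⟨μ, hμ, hρμ⟩ := exists_mem_maxCones (hs.finite hG i j) hρ
    exact hρμ.trans (by_contra fun h' => h i j μ ⟨hμ, h'⟩)
  refine ⟨hs, hface, fun i j α hα β hβ => ?_⟩
  obtain ⟨μ, hμ, hle, himp⟩ := hs.closed i j α hα β hβ
  exact himp (((hβ.trans (hface i j α hα)).isFaceOf_iff_le (hface i j μ hμ)).2 hle)

theorem IsFaceAdmissible.ne_of_notTransitive (hs : s.IsFaceAdmissible G) {i j k : I}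
    {ρ : PointedCone ℝ (ℝ ⊗[ℤ] M)} (h : s.NotTransitive i j k ρ) : i ≠ k := by
  rintro rfl
  refine h.2 ?_
  rw [hs.self]
  exact hs.isFaceOf _ _ _ h.1.1

theorem glue_cones (hs : s.IsAdmissible G) (i k : I) (ρ : PointedCone ℝ (ℝ ⊗[ℤ] M)) (a b : I) :
    (s.glue i k ρ).cones a b = s.cones a b ∪
      {τ | ((a = i ∧ b = k) ∨ (a = k ∧ b = i)) ∧ τ.IsFaceOf ρ} := by
  by_cases h : (a = i ∧ b = k) ∨ (a = k ∧ b = i)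
  · have h1 : s.cones a b = s.cones i k := by
      rcases h with ⟨rfl, rfl⟩ | ⟨rfl, rfl⟩
      exacts [rfl, hs.symm _ _]
    simp only [glue, h, if_true, true_and, h1]
    rfl
  · simp [glue, h]

/-- The cone ρ is a common face of τ(i) and τ(k), so adding its faces is harmless, and the diagonal
is untouched because i ≠ k. -/
theorem IsFaceAdmissible.glue (hs : s.IsFaceAdmissible G) {i j k : I}
    {ρ : PointedCone ℝ (ℝ ⊗[ℤ] M)} (h : s.NotTransitive i j k ρ) :
    (s.glue i k ρ).IsFaceAdmissible G := by
  have hik := hs.ne_of_notTransitive h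
  have hmem : ∀ a b, ∀ α ∈ (s.glue i k ρ).cones a b, α ∈ s.cones a b ∨
      ((a = i ∧ b = k) ∨ (a = k ∧ b = i)) ∧ α.IsFaceOf ρ := by
    intro a b α hα
    rwa [glue_cones hs.toIsAdmissible] at hα
  have hρi : ρ.IsFaceOf (s.tau i) := hs.isFaceOf i j ρ h.1.1
  have hρk : ρ.IsFaceOf (s.tau k) := hs.isFaceOf k j ρ (by rw [hs.symm]; exact h.1.2)
  have hface : ∀ a b, ∀ α ∈ (s.glue i k ρ).cones a b, α.IsFaceOf (s.tau a) := by
    intro a b α hα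
    rcases hmem a b α hα with h1 | ⟨⟨rfl, rfl⟩ | ⟨rfl, rfl⟩, h1⟩
    exacts [hs.isFaceOf a b α h1, h1.trans hρi, h1.trans hρk]
  have hface_mem : ∀ a b, ∀ α ∈ (s.glue i k ρ).cones a b, ∀ β : PointedCone ℝ (ℝ ⊗[ℤ] M),
      β.IsFaceOf α → β ∈ (s.glue i k ρ).cones a b := by
    intro a b α hα β hβ
    rw [glue_cones hs.toIsAdmissible] at hα ⊢
    rcases hα with h1 | h1
    exacts [Or.inl (hs.face_mem a b α h1 β hβ), Or.inr ⟨h1.1, hβ.trans h1.2⟩]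
  refine ⟨⟨hs.tau_gen, ?_, ?_, ?_, ?_, fun a b α hα => (hface a b α hα).le, ?_⟩, hface, hface_mem⟩
  · exact fun a b α hα => (hs.tau_gen a).isFaceOf (hface a b α hα)
  · intro a b
    rw [glue_cones hs.toIsAdmissible]
    exact (hs.nonempty a b).mono Set.subset_union_left
  · intro a b
    rw [glue_cones hs.toIsAdmissible, glue_cones hs.toIsAdmissible, hs.symm a b]
    congr 1
    ext τ
    simp only [Set.mem_ofPred_eq]
    tauto
  · intro a
    rw [glue_cones hs.toIsAdmissible, hs.self]
    refine Set.union_eq_left.2 ?_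
    rintro τ ⟨⟨rfl, rfl⟩ | ⟨rfl, rfl⟩, -⟩ <;> exact absurd rfl hik
  · exact fun a b α hα β hβ => ⟨β, hface_mem a b α hα β hβ, le_rfl,
      fun _ => hface_mem a b α hα β hβ⟩

variable {N : Type*} [AddCommGroup N] {S : AffineQuasiFanSystem N I} {P : N →+ M}

/-- For the relative interiors the point is that ρ, hence τ(j), meets the relative interior of κ; so
adjoining κ to τ(j) does not push interior points to the boundary. -/
theorem Covers.enlarge (hc : s.Covers S P) (hs : s.IsAdmissible G) (hG : G.Finite) {i j : I}
    {ρ κ : PointedCone ℝ (ℝ ⊗[ℤ] M)} (h : s.Violates i j ρ) (hκ : s.IsEnvelopingFace i ρ κ)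
    (hS : ∀ i, (coneRelInterior (S.cone i)).Nonempty) :
    (s.enlarge i j ρ κ).Covers S P := by
  have hij := hs.ne_of_violates h
  have hne := (hs.cones_gen i j ρ h.1.1).nonempty hG
  have hρκ : ρ ≤ κ := hκ.le hne (hs.le i j ρ h.1.1)
  have hrepl : ∀ a b, ∀ σ ∈ S.fan a b,
      ∃ τ ∈ (s.cones a b \ coneFaces ρ) ∪ coneFaces κ, σ.map (realExt P) ≤ τ := by
    intro a b σ hσ
    obtain ⟨τ, hτ, hle⟩ := hc.cover a b σ hσ
    by_cases hτρ : τ.IsFaceOf ρ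
    · exact ⟨κ, Or.inr (PointedCone.IsFaceOf.refl κ), hle.trans (hτρ.le.trans hρκ)⟩
    · exact ⟨τ, Or.inl ⟨hτ, hτρ⟩, hle⟩
  constructor
  · refine enlarge_cones_induction (ρ := ρ) (κ := κ) (s := s) hij ?_ ?_ ?_ ?_
    · rw [enlarge_cones_self]
      intro σ hσ
      obtain ⟨τ, hτ, hle⟩ := hc.cover j j σ hσ
      exact ⟨_, PointedCone.IsFaceOf.refl _, hle.trans ((hs.le j j τ hτ).trans le_sup_left)⟩
    · rw [enlarge_cones_left ρ κ hij]; exact hrepl i j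
    · rw [enlarge_cones_right ρ κ hij]; exact hrepl j i
    · intro a b hab
      rw [hab]; exact hc.cover a b
  · intro a
    by_cases ha : a = j
    · subst ha
      rw [enlarge_tau_self]
      refine (hc.relInterior a).trans ?_
      obtain ⟨x, hx⟩ := hS a
      have hx' := hc.relInterior a ⟨x, hx, rfl⟩
      refine coneRelInterior_subset le_sup_left hx'.1 ⟨le_sup_left (a := s.tau a) hx'.1, ?_⟩
      intro y hy
      obtain ⟨y, hyτ, z, hz, rfl⟩ := Submodule.mem_sup.1 hy
      obtain ⟨r, hr⟩ := hne
      have hrτ : r ∈ s.tau a := hs.le a i ρ (by rw [hs.symm]; exact h.1.1) hr.1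
      obtain ⟨ε, hε, h1⟩ := (hκ.2 hr).2 z hz
      -- Subtracting an extra multiple of r inside of τ(j) leaves room to subtract z, because r - ε
      -- • z lies in κ.
      obtain ⟨δ, hδ, h2⟩ := hx'.2 (ε • y + r)
        ((s.tau a).add_mem ((s.tau a).smul_mem hε.le hyτ) hrτ)
      refine ⟨δ * ε, mul_pos hδ hε, ?_⟩
      have h3 : realExt P x - (δ * ε) • (y + z) =
          (realExt P x - δ • (ε • y + r)) + δ • (r - ε • z) := by module
      rw [h3]
      exact Submodule.add_mem_sup h2 (κ.smul_mem hδ.le h1)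
    · rw [enlarge_tau_of_ne ρ κ ha]; exact hc.relInterior a

theorem Covers.glue (hc : s.Covers S P) (hs : s.IsAdmissible G) (i k : I)
    (ρ : PointedCone ℝ (ℝ ⊗[ℤ] M)) : (s.glue i k ρ).Covers S P := by
  refine ⟨fun a b σ hσ => ?_, hc.relInterior⟩
  obtain ⟨τ, hτ, hle⟩ := hc.cover a b σ hσ
  exact ⟨τ, by rw [glue_cones hs]; exact Or.inl hτ, hle⟩

end

theorem IsAdmissible.init {N : Type*} [AddCommGroup N] (S : AffineQuasiFanSystem N I)
    (L : AddSubgroup N) {G : Set (ℝ ⊗[ℤ] N)} (hG : ∀ i, IsGeneratedIn G (S.cone i)) :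
    (ConeData.init S L).IsAdmissible (realExt (QuotientAddGroup.mk' L) '' G) := by
  have hface : ∀ i j, ∀ ρ ∈ S.fan i j, ρ.IsFaceOf (S.cone i) := by
    intro i j ρ hρ
    have h1 := S.fan_subset_left i j hρ
    rwa [S.fan_self] at h1
  refine ⟨fun i => (hG i).map _, ?_, ?_, ?_, ?_, ?_, ?_⟩
  · rintro i j τ ⟨ρ, hρ, hτ⟩
    exact (((hG i).isFaceOf (hface i j ρ hρ.1)).map _).isFaceOf hτ
  · intro i j
    obtain ⟨σ, hσ⟩ := (S.isQuasiFan i j).nonempty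
    obtain ⟨μ, hμ, -⟩ := exists_mem_maxCones (S.isQuasiFan i j).finite hσ
    exact ⟨_, μ, hμ, PointedCone.IsFaceOf.refl _⟩
  · intro i j
    simp only [ConeData.init, S.symm i j]
  · intro i
    simp only [ConeData.init, S.fan_self, maxCones_coneFaces, Set.mem_singleton_iff,
      exists_eq_left]
    rfl
  · rintro i j τ ⟨ρ, hρ, hτ⟩
    exact hτ.le.trans (Submodule.map_mono (hface i j ρ hρ.1).le)
  · rintro i j α ⟨ρ, hρ, hα⟩ β hβ
    have : β ∈ (ConeData.init S L).cones i j := ⟨ρ, hρ, hβ.trans hα⟩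
    exact ⟨β, this, le_rfl, fun _ => this⟩

theorem Covers.init {N : Type*} [AddCommGroup N] (S : AffineQuasiFanSystem N I)
    (L : AddSubgroup N) :
    (ConeData.init S L).Covers S (QuotientAddGroup.mk' L) := by
  constructor
  · intro i j σ hσ
    obtain ⟨μ, hμ, hf⟩ := exists_mem_maxCones (S.isQuasiFan i j).finite hσ
    exact ⟨_, ⟨μ, hμ, PointedCone.IsFaceOf.refl _⟩, Submodule.map_mono hf.le⟩
  · intro i
    rintro _ ⟨x, hx, rfl⟩
    refine ⟨⟨x, hx.1, rfl⟩, ?_⟩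
    rintro _ ⟨y, hy, rfl⟩
    obtain ⟨ε, hε, h⟩ := hx.2 y hy
    exact ⟨ε, hε, _, h, by simp⟩

end ConeData

/-! ### Termination measures. -/

/-- The number of elements of `G` outside of the cone `σ`. -/
noncomputable def coneWeight {V : Type*} [AddCommGroup V] [Module ℝ V] (G : Set V)
    (σ : PointedCone ℝ V) : ℕ :=
  (G \ σ).ncard

section

variable {V : Type*} [AddCommGroup V] [Module ℝ V] {G : Set V}

theorem coneWeight_anti (hG : G.Finite) {σ τ : PointedCone ℝ V} (h : σ ≤ τ) :
    coneWeight G τ ≤ coneWeight G σ :=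
  Set.ncard_le_ncard (Set.sdiff_subset_sdiff_right h) hG.sdiff

theorem coneWeight_lt (hG : G.Finite) {σ τ : PointedCone ℝ V} (hτ : IsGeneratedIn G τ)
    (h : σ < τ) : coneWeight G τ < coneWeight G σ := by
  obtain ⟨g, hg, h1, h2⟩ := hτ.exists_mem_of_not_le h.not_ge
  refine Set.ncard_lt_ncard ?_ hG.sdiff
  exact ⟨Set.sdiff_subset_sdiff_right h.le, fun h' => (h' ⟨hg, h2⟩).2 h1⟩

end

namespace ConeData

variable {M : Type*} [AddCommGroup M] {I : Type*}

/-- The first measure of progress in Loop 1. -/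
noncomputable def tauWeight [Fintype I] (G : Set (ℝ ⊗[ℤ] M)) (s : ConeData M I) : ℕ :=
  ∑ i, coneWeight G (s.tau i)

/-- The second measure of progress in Loop 1. -/
noncomputable def maxWeight [Fintype I] (G : Set (ℝ ⊗[ℤ] M)) (s : ConeData M I) : ℕ :=
  ∑ p : I × I, ∑ᶠ ρ ∈ maxCones (s.cones p.1 p.2), coneWeight G ρ

/-- The measure of progress in Loop 2. -/
noncomputable def missing [Fintype I] (G : Set (ℝ ⊗[ℤ] M)) (s : ConeData M I) : ℕ :=
  ∑ p : I × I, ({ρ | IsGeneratedIn G ρ} \ s.cones p.1 p.2).ncard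

variable {G : Set (ℝ ⊗[ℤ] M)} {s : ConeData M I}

theorem finsum_maxCones_replace_lt {V : Type*} [AddCommGroup V] [Module ℝ V]
    {A : Set (PointedCone ℝ V)} (hA : A.Finite) {ρ κ : PointedCone ℝ V} (hρ : ρ ∈ maxCones A)
    {f : PointedCone ℝ V → ℕ} (h : f κ < f ρ) :
    ∑ᶠ α ∈ maxCones ((A \ coneFaces ρ) ∪ coneFaces κ), f α < ∑ᶠ α ∈ maxCones A, f α := by
  classical
  have hfin : (maxCones A).Finite := hA.subset fun _ h => h.1
  have hsub := maxCones_replace_subset hA ρ κ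
  have hfin' : (maxCones ((A \ coneFaces ρ) ∪ coneFaces κ)).Finite :=
    (hfin.sdiff.insert κ).subset hsub
  rw [finsum_mem_eq_finite_toFinset_sum _ hfin, finsum_mem_eq_finite_toFinset_sum _ hfin']
  calc ∑ α ∈ hfin'.toFinset, f α ≤ ∑ α ∈ insert κ (hfin.toFinset.erase ρ), f α := by
        refine Finset.sum_le_sum_of_subset fun α hα => ?_
        have h1 := hsub (hfin'.mem_toFinset.1 hα)
        simpa [and_comm] using h1
    _ ≤ f κ + ∑ α ∈ hfin.toFinset.erase ρ, f α := by
        -- The cone κ may already be maximal in A; it is then counted only once.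
        by_cases hm : κ ∈ hfin.toFinset.erase ρ
        · rw [Finset.insert_eq_of_mem hm]; exact Nat.le_add_left _ _
        · rw [Finset.sum_insert hm]
    _ < f ρ + ∑ α ∈ hfin.toFinset.erase ρ, f α := by gcongr
    _ = ∑ α ∈ hfin.toFinset, f α := Finset.add_sum_erase _ _ (hfin.mem_toFinset.2 hρ)

/-- Either κ is not contained in τ(j), and τ(j) grows; or all τ stay the same, and in S_ij a maximal
cone ρ gives way to the strictly larger κ (if ρ = κ, then ρ would be a face of τ(i)). -/
theorem IsAdmissible.weight_enlarge_lt [Fintype I] (hs : s.IsAdmissible G) (hG : G.Finite)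
    {i j : I} {ρ κ : PointedCone ℝ (ℝ ⊗[ℤ] M)} (h : s.Violates i j ρ)
    (hκ : s.IsEnvelopingFace i ρ κ) :
    (s.enlarge i j ρ κ).tauWeight G < s.tauWeight G ∨
      (s.enlarge i j ρ κ).tauWeight G = s.tauWeight G ∧
        (s.enlarge i j ρ κ).maxWeight G < s.maxWeight G := by
  have hij := hs.ne_of_violates h
  have hle := fun a => coneWeight_anti hG (tau_le_enlarge (s := s) i j ρ κ a)
  by_cases hκj : κ ≤ s.tau j
  · right
    have htau : (s.enlarge i j ρ κ).tau j = s.tau j := by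
      rw [enlarge_tau_self]; exact sup_eq_left.2 hκj
    have htau' : (s.enlarge i j ρ κ).tau = s.tau := by
      ext1 a
      by_cases ha : a = j
      · subst ha; exact htau
      · exact enlarge_tau_of_ne ρ κ ha
    refine ⟨by simp only [tauWeight, htau'], ?_⟩
    have hρκ : ρ < κ := by
      refine lt_of_le_of_ne
        (hκ.le ((hs.cones_gen i j ρ h.1.1).nonempty hG) (hs.le i j ρ h.1.1)) ?_
      rintro rfl
      exact h.2 hκ.1
    have hw := coneWeight_lt hG ((hs.tau_gen i).isFaceOf hκ.1) hρκ
    have hlt : ∀ a b, ρ ∈ maxCones (s.cones a b) →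
        ∑ᶠ α ∈ maxCones ((s.cones a b \ coneFaces ρ) ∪ coneFaces κ), coneWeight G α <
          ∑ᶠ α ∈ maxCones (s.cones a b), coneWeight G α := fun a b hρ =>
      finsum_maxCones_replace_lt (hs.finite hG a b) hρ hw
    refine Finset.sum_lt_sum (fun p _ => ?_) ⟨(i, j), Finset.mem_univ _, ?_⟩
    · refine enlarge_cones_induction (s := s) (ρ := ρ) (κ := κ) hij
        (p := fun a b => ∑ᶠ α ∈ maxCones ((s.enlarge i j ρ κ).cones a b), coneWeight G α ≤
          ∑ᶠ α ∈ maxCones (s.cones a b), coneWeight G α) ?_ ?_ ?_ ?_ p.1 p.2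
      · rw [enlarge_cones_self, ← enlarge_tau_self i j ρ κ, htau, hs.self]
      · rw [enlarge_cones_left ρ κ hij]; exact (hlt i j h.1).le
      · rw [enlarge_cones_right ρ κ hij]; exact (hlt j i (by rw [hs.symm]; exact h.1)).le
      · intro a b hab
        rw [hab]
    · simp only [enlarge_cones_left ρ κ hij]
      exact hlt i j h.1
  · left
    refine Finset.sum_lt_sum (fun a _ => hle a) ⟨j, Finset.mem_univ _, ?_⟩
    rw [enlarge_tau_self]
    refine coneWeight_lt hG ((hs.tau_gen j).sup ((hs.tau_gen i).isFaceOf hκ.1)) ?_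
    exact left_lt_sup.2 hκj

theorem IsFaceAdmissible.missing_glue_lt [Fintype I] (hs : s.IsFaceAdmissible G) (hG : G.Finite)
    {i j k : I} {ρ : PointedCone ℝ (ℝ ⊗[ℤ] M)} (h : s.NotTransitive i j k ρ) :
    (s.glue i k ρ).missing G < s.missing G := by
  have hfin := finite_isGeneratedIn hG
  have hsub : ∀ a b, s.cones a b ⊆ (s.glue i k ρ).cones a b := fun a b => by
    rw [glue_cones hs.toIsAdmissible]; exact Set.subset_union_left
  refine Finset.sum_lt_sum (fun p _ => Set.ncard_le_ncard
    (Set.sdiff_subset_sdiff_right (hsub _ _)) hfin.sdiff) ⟨(i, k), Finset.mem_univ _, ?_⟩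
  refine Set.ncard_lt_ncard ⟨Set.sdiff_subset_sdiff_right (hsub _ _), fun h' => ?_⟩ hfin.sdiff
  refine (h' ⟨hs.cones_gen i j ρ h.1.1, h.2⟩).2 ?_
  rw [glue_cones hs.toIsAdmissible]
  exact Or.inr ⟨Or.inl ⟨rfl, rfl⟩, PointedCone.IsFaceOf.refl ρ⟩

end ConeData

/-! ### Invariants and progress along runs. -/

namespace AlgConfig

variable {M : Type*} [AddCommGroup M] {I : Type*}

/-- The invariant of the algorithm. -/
def IsAdmissible (G : Set (ℝ ⊗[ℤ] M)) : AlgConfig M I → Prop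
  | .loop1 s => s.IsAdmissible G
  | .loop2 s => s.IsFaceAdmissible G
  | .output s => s.IsFaceAdmissible G ∧ ∀ i j k ρ, ¬ s.NotTransitive i j k ρ

/-- The measure of progress of the algorithm. -/
noncomputable def weight [Fintype I] (G : Set (ℝ ⊗[ℤ] M)) : AlgConfig M I → ℕ ×ₗ ℕ ×ₗ ℕ
  | .loop1 s => toLex (2, toLex (s.tauWeight G, s.maxWeight G))
  | .loop2 s => toLex (1, toLex (s.missing G, 0))
  | .output _ => toLex (0, toLex (0, 0))

variable {G : Set (ℝ ⊗[ℤ] M)} {c c' : AlgConfig M I}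

theorem IsAdmissible.isAdmissible_data (hc : c.IsAdmissible G) : c.data.IsAdmissible G := by
  cases c with
  | loop1 s => exact hc
  | loop2 s => exact hc.toIsAdmissible
  | output s => exact hc.1.toIsAdmissible

theorem IsAdmissible.step (hc : c.IsAdmissible G) (hG : G.Finite) (h : AlgStep c c') :
    c'.IsAdmissible G := by
  cases h with
  | enlarge s i j ρ κ h hκ => exact ConeData.IsAdmissible.enlarge hc hG h hκ
  | leave1 s h => exact ConeData.IsAdmissible.isFaceAdmissible hc hG h
  | glue s i j k ρ h => exact ConeData.IsFaceAdmissible.glue hc h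
  | leave2 s h => exact ⟨hc, h⟩

theorem IsAdmissible.weight_lt [Fintype I] (hc : c.IsAdmissible G) (hG : G.Finite)
    (h : AlgStep c c') : c'.weight G < c.weight G := by
  cases h with
  | enlarge s i j ρ κ h hκ =>
    have := ConeData.IsAdmissible.weight_enlarge_lt hc hG h hκ
    simpa [weight, Prod.Lex.toLex_lt_toLex] using this
  | leave1 s h => simp [weight, Prod.Lex.toLex_lt_toLex]
  | glue s i j k ρ h =>
    have := ConeData.IsFaceAdmissible.missing_glue_lt hc hG h
    simpa [weight, Prod.Lex.toLex_lt_toLex] using this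
  | leave2 s h => simp [weight, Prod.Lex.toLex_lt_toLex]

theorem IsAdmissible.exists_step (hc : c.IsAdmissible G) (hG : G.Finite)
    (h : ∀ s, c ≠ .output s) : ∃ c', AlgStep c c' := by
  cases c with
  | loop1 s =>
    by_cases h' : ∀ i j ρ, ¬ s.Violates i j ρ
    · exact ⟨_, .leave1 s h'⟩
    · push Not at h'
      obtain ⟨i, j, ρ, hv⟩ := h'
      obtain ⟨κ, hκ, -⟩ := ConeData.IsAdmissible.existsUnique_isEnvelopingFace hc hG hv.1.1
      exact ⟨_, .enlarge s i j ρ κ hv hκ⟩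
  | loop2 s =>
    by_cases h' : ∀ i j k ρ, ¬ s.NotTransitive i j k ρ
    · exact ⟨_, .leave2 s h'⟩
    · push Not at h'
      obtain ⟨i, j, k, ρ, hv⟩ := h'
      exact ⟨_, .glue s i j k ρ hv⟩
  | output s => exact absurd rfl (h s)

theorem IsAdmissible.covers_step {N : Type*} [AddCommGroup N] {S : AffineQuasiFanSystem N I}
    {P : N →+ M} (hc : c.IsAdmissible G) (hG : G.Finite)
    (hS : ∀ i, (coneRelInterior (S.cone i)).Nonempty) (h : AlgStep c c')
    (hP : c.data.Covers S P) : c'.data.Covers S P := by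
  cases h with
  | enlarge s i j ρ κ h hκ => exact ConeData.Covers.enlarge hP hc hG h hκ hS
  | leave1 s h => exact hP
  | glue s i j k ρ h => exact ConeData.Covers.glue hP hc.toIsAdmissible i k ρ
  | leave2 s h => exact hP

end AlgConfig

theorem AffineQuasiFanSystem.isLatticeCone_cone {N : Type*} [AddCommGroup N] {I : Type*}
    (S : AffineQuasiFanSystem N I) (i : I) : IsLatticeCone (S.cone i) :=
  (S.isQuasiFan i i).isLatticeCone _ (by rw [S.fan_self]; exact PointedCone.IsFaceOf.refl _)

theorem AffineQuasiFanSystem.exists_generators {N : Type*} [AddCommGroup N] {I : Type*} [Finite I]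
    (S : AffineQuasiFanSystem N I) : ∃ A : Set N, A.Finite ∧
      ∀ i, IsGeneratedIn ((fun n : N => (1 : ℝ) ⊗ₜ[ℤ] n) '' A) (S.cone i) := by
  choose A hA hgen using fun i => isLatticeCone_iff.1 (S.isLatticeCone_cone i)
  exact ⟨⋃ i, A i, Set.finite_iUnion hA, fun i =>
    (hgen i).mono (Set.image_mono (Set.subset_iUnion A i))⟩

theorem image_realExt_image_tmul {N M : Type*} [AddCommGroup N] [AddCommGroup M] (P : N →+ M)
    (A : Set N) : realExt P '' ((fun n : N => (1 : ℝ) ⊗ₜ[ℤ] n) '' A) =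
      (fun n : M => (1 : ℝ) ⊗ₜ[ℤ] n) '' (P '' A) := by
  simp only [Set.image_image]
  rfl

theorem AlgReaches.isAdmissible {N : Type*} [AddCommGroup N] {I : Type*}
    {S : AffineQuasiFanSystem N I} {L : AddSubgroup N} {G : Set (ℝ ⊗[ℤ] N)} (hG : G.Finite)
    (hS : ∀ i, IsGeneratedIn G (S.cone i)) {c : AlgConfig (N ⧸ L) I} (h : AlgReaches S L c) :
    c.IsAdmissible (realExt (QuotientAddGroup.mk' L) '' G) := by
  induction h with
  | refl => exact ConeData.IsAdmissible.init S L hS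
  | tail _ hstep ih => exact ih.step (hG.image _) hstep

theorem AlgReaches.covers {N : Type*} [AddCommGroup N] {I : Type*} [Finite I]
    {S : AffineQuasiFanSystem N I} {L : AddSubgroup N} {c : AlgConfig (N ⧸ L) I}
    (h : AlgReaches S L c) : c.data.Covers S (QuotientAddGroup.mk' L) := by
  obtain ⟨A, hA, hgen⟩ := S.exists_generators
  induction h with
  | refl => exact ConeData.Covers.init S L
  | tail hr hstep ih =>
    exact (AlgReaches.isAdmissible (hA.image _) hgen hr).covers_step ((hA.image _).image _)
      (fun i => (S.isLatticeCone_cone i).coneRelInterior_nonempty) hstep ih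

theorem realExt_comp_apply {N M M' : Type*} [AddCommGroup N] [AddCommGroup M] [AddCommGroup M']
    (g : M →+ M') (f : N →+ M) (x : ℝ ⊗[ℤ] N) :
    realExt (g.comp f) x = realExt g (realExt f x) := by
  have : (g.comp f).toIntLinearMap = g.toIntLinearMap.comp f.toIntLinearMap := rfl
  simp only [realExt, this, LinearMap.baseChange_comp, LinearMap.comp_apply]

/-! ### Classes in systems of quasi-fans. -/

namespace QuasiFanSystem

variable {N : Type*} [AddCommGroup N] {I : Type*} {S : QuasiFanSystem N I}

theorem mkClass_le_mkClass {i : I} {σ τ : PointedCone ℝ (ℝ ⊗[ℤ] N)} (hτ : τ ∈ S.fan i i)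
    (hσ : σ ∈ S.fan i i) (h : τ.IsFaceOf σ) : S.mkClass i τ hτ ≤ S.mkClass i σ hσ :=
  ⟨i, τ, hτ, i, σ, hσ, rfl, rfl, h, hτ⟩

theorem exists_of_le_mkClass {i : I} {σ : PointedCone ℝ (ℝ ⊗[ℤ] N)} {hσ : σ ∈ S.fan i i}
    {a : S.Classes} (h : a ≤ S.mkClass i σ hσ) :
    ∃ τ hτ, a = S.mkClass i τ hτ ∧ τ.IsFaceOf σ := by
  obtain ⟨j, τ, hτ, k, σ', hσ', rfl, h', hf, hm⟩ := h
  obtain ⟨rfl, hk⟩ := mkClass_eq_iff.1 h'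
  -- The order provides representatives at some indices j and k; closure under faces and
  -- transitivity move τ to the index i.
  have h1 : τ ∈ S.fan k i := (S.isQuasiFan k i).face_mem _ hk _ hf
  have h2 : τ ∈ S.fan j i := S.trans j k i ⟨by rw [S.symm]; exact hm, h1⟩
  exact ⟨τ, S.fan_subset_right j i h2, mkClass_eq_iff.2 ⟨rfl, h2⟩, hf⟩

theorem coneRelInterior_nonempty {i j : I} {σ : PointedCone ℝ (ℝ ⊗[ℤ] N)} (h : σ ∈ S.fan i j) :
    (coneRelInterior σ).Nonempty :=
  ((S.isQuasiFan i j).isLatticeCone σ h).coneRelInterior_nonempty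

end QuasiFanSystem

namespace AffineQuasiFanSystem

variable {N : Type*} [AddCommGroup N] {I : Type*} (S : AffineQuasiFanSystem N I)

theorem cone_mem (i : I) : S.cone i ∈ S.fan i i := by
  rw [S.fan_self]; exact PointedCone.IsFaceOf.refl _

theorem isFaceOf_left {i j : I} {σ : PointedCone ℝ (ℝ ⊗[ℤ] N)} (h : σ ∈ S.fan i j) :
    σ.IsFaceOf (S.cone i) := by
  have := S.fan_subset_left i j h
  rwa [S.fan_self] at this

theorem isFaceOf_right {i j : I} {σ : PointedCone ℝ (ℝ ⊗[ℤ] N)} (h : σ ∈ S.fan i j) :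
    σ.IsFaceOf (S.cone j) := by
  rw [S.symm] at h; exact S.isFaceOf_left h

end AffineQuasiFanSystem

/-! ### Extending homomorphisms to maps of systems. -/

/-- The homomorphism `F` maps the cones of `cones i j` into common faces of `ω i` and `ω j` which
belong to the quasi-fan with indices `m i` and `m j`. -/
def IsAdapted {M M' I J : Type*} [AddCommGroup M] [AddCommGroup M'] (R : QuasiFanSystem M' J)
    (F : M →+ M') (m : I → J) (ω : I → PointedCone ℝ (ℝ ⊗[ℤ] M'))
    (cones : I → I → Set (PointedCone ℝ (ℝ ⊗[ℤ] M))) : Prop :=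
  ∀ i j, ∀ σ ∈ cones i j, ∃ ω' ∈ R.fan (m i) (m j), ω'.IsFaceOf (ω i) ∧ ω'.IsFaceOf (ω j) ∧
    σ ≤ ω'.comap (realExt F)

section

variable {M M' I J : Type*} [AddCommGroup M] [AddCommGroup M'] {S : QuasiFanSystem M I}
  {R : QuasiFanSystem M' J} {F : M →+ M'} {m : I → J} {ω : I → PointedCone ℝ (ℝ ⊗[ℤ] M')}

theorem IsAdapted.exists_face (h : IsAdapted R F m ω S.fan) {i : I}
    {σ : PointedCone ℝ (ℝ ⊗[ℤ] M)} (hσ : σ ∈ S.fan i i) :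
    ∃ e : PointedCone ℝ (ℝ ⊗[ℤ] M'), e.IsFaceOf (ω i) ∧
      realExt F '' coneRelInterior σ ⊆ coneRelInterior e := by
  obtain ⟨ω', -, hf, -, hle⟩ := h i i σ hσ
  obtain ⟨e, he, hi⟩ := exists_face_image_subset (S.coneRelInterior_nonempty hσ) hle
  exact ⟨e, he.trans hf, hi⟩

/-- The image of the relative interior of σ lies in that of a face of the common face ω'; by
uniqueness this face is e. It makes the map on classes independent of the index. -/
theorem IsAdapted.mem_fan (h : IsAdapted R F m ω S.fan) {i j : I}
    {σ : PointedCone ℝ (ℝ ⊗[ℤ] M)} (hσ : σ ∈ S.fan i j) {e : PointedCone ℝ (ℝ ⊗[ℤ] M')}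
    (he : e.IsFaceOf (ω i)) (hi : realExt F '' coneRelInterior σ ⊆ coneRelInterior e) :
    e ∈ R.fan (m i) (m j) ∧ e.IsFaceOf (ω j) := by
  obtain ⟨ω', hω', hf, hf', hle⟩ := h i j σ hσ
  have hne := S.coneRelInterior_nonempty hσ
  obtain ⟨e', he', hi'⟩ := exists_face_image_subset hne hle
  obtain rfl := eq_of_image_subset hne he (he'.trans hf) hi hi'
  exact ⟨(R.isQuasiFan _ _).face_mem _ hω' _ he', he'.trans hf'⟩

/-- An adapted homomorphism extends to a map of systems of quasi-fans. -/
theorem IsAdapted.exists_map (h : IsAdapted R F m ω S.fan) (hω : ∀ i, ω i ∈ R.fan (m i) (m i)) :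
    ∃ g : QuasiFanMap S R, g.hom = F ∧ ∀ i σ hσ,
      g.onClasses (S.mkClass i σ hσ) ≤ R.mkClass (m i) (ω i) (hω i) := by
  choose e he hi using fun p : S.Labelled => h.exists_face p.mem
  have hmem : ∀ p, e p ∈ R.fan (m p.idx) (m p.idx) := fun p =>
    (R.isQuasiFan _ _).face_mem _ (hω _) _ (he p)
  let φ : S.Classes → R.Classes := Quotient.lift (s := S.glueing)
    (fun p => R.mkClass (m p.idx) (e p) (hmem p)) (by
      rintro ⟨σ, i, hσ⟩ ⟨σ', j, hσ'⟩ ⟨h1, h2⟩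
      obtain rfl : σ = σ' := h1
      obtain ⟨h3, h4⟩ := h.mem_fan (i := i) (j := j) h2 (he ⟨σ, i, hσ⟩) (hi ⟨σ, i, hσ⟩)
      have h5 : e ⟨σ, i, hσ⟩ = e ⟨σ, j, hσ'⟩ := eq_of_image_subset
        (S.coneRelInterior_nonempty hσ) h4 (he ⟨σ, j, hσ'⟩) (hi ⟨σ, i, hσ⟩) (hi ⟨σ, j, hσ'⟩)
      exact QuasiFanSystem.mkClass_eq_iff.2 ⟨h5, h3⟩)
  have hφ : ∀ i σ hσ, φ (S.mkClass i σ hσ) =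
      R.mkClass (m i) (e ⟨σ, i, hσ⟩) (hmem ⟨σ, i, hσ⟩) := fun i σ hσ => rfl
  refine ⟨⟨F, φ, ?_, ?_⟩, rfl, fun i σ hσ => ?_⟩
  · rintro _ b ⟨j, τ, hτ, i, σ, hσ, rfl, rfl, hf, hm⟩
    have hτi := S.fan_subset_left i j hm
    have hji : S.mkClass j τ hτ = S.mkClass i τ hτi :=
      QuasiFanSystem.mkClass_eq_iff.2 ⟨rfl, by rw [S.symm]; exact hm⟩
    -- With both classes represented at i, the two images are faces of ω i, so it suffices to
    -- compare them by inclusion.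
    rw [hji, hφ, hφ]
    refine QuasiFanSystem.mkClass_le_mkClass _ _ ?_
    rw [(he ⟨τ, i, hτi⟩).isFaceOf_iff_le (he ⟨σ, i, hσ⟩)]
    obtain ⟨x, hx⟩ := S.coneRelInterior_nonempty hτ
    obtain ⟨ω', -, hf', -, hle⟩ := h i i σ hσ
    have hle' := le_comap_of_image_subset (S.coneRelInterior_nonempty hσ)
      (hle.trans (Submodule.comap_mono hf'.le)) (he ⟨σ, i, hσ⟩) (hi ⟨σ, i, hσ⟩)
    exact (he ⟨σ, i, hσ⟩).le_of_mem_coneRelInterior (he ⟨τ, i, hτi⟩).le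
      (hi ⟨τ, i, hτi⟩ ⟨x, hx, rfl⟩) (hle' (hf.le hx.1))
  · intro i σ hσ i' σ' hσ' h1
    rw [hφ] at h1
    rw [← (QuasiFanSystem.mkClass_eq_iff.1 h1).1]
    exact hi ⟨σ, i, hσ⟩
  · exact QuasiFanSystem.mkClass_le_mkClass _ _ (he ⟨σ, i, hσ⟩)

/-- The bounds place both values at the same index m i, as faces of ω i; the relative interior
containing the image of that of σ singles out one face. -/
theorem QuasiFanMap.eq_of_le {g g' : QuasiFanMap S R} (hom : g.hom = g'.hom)
    (hω : ∀ i, ω i ∈ R.fan (m i) (m i))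
    (hg : ∀ i σ hσ, g.onClasses (S.mkClass i σ hσ) ≤ R.mkClass (m i) (ω i) (hω i))
    (hg' : ∀ i σ hσ, g'.onClasses (S.mkClass i σ hσ) ≤ R.mkClass (m i) (ω i) (hω i)) :
    g = g' := by
  refine QuasiFanMap.ext hom (funext fun a => ?_)
  obtain ⟨i, σ, hσ, rfl⟩ := QuasiFanSystem.exists_mkClass a
  obtain ⟨e, he, h1, hf⟩ := QuasiFanSystem.exists_of_le_mkClass (hg i σ hσ)
  obtain ⟨e', he', h1', hf'⟩ := QuasiFanSystem.exists_of_le_mkClass (hg' i σ hσ)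
  have hi := g.image_relInterior i σ hσ _ e he h1
  have hi' := g'.image_relInterior i σ hσ _ e' he' h1'
  rw [← hom] at hi'
  obtain rfl := eq_of_image_subset (S.coneRelInterior_nonempty hσ) hf hf' hi hi'
  rw [h1, h1']

/-- A map of systems controls relative interiors only; a boundary point is interior to a face of σ,
whose class is sent below that of τ by monotonicity. -/
theorem QuasiFanMap.le_comap (f : QuasiFanMap S R) {i : I} {σ : PointedCone ℝ (ℝ ⊗[ℤ] M)}
    (hσ : σ ∈ S.fan i i) {k : J} {τ : PointedCone ℝ (ℝ ⊗[ℤ] M')} (hτ : τ ∈ R.fan k k)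
    (h : f.onClasses (S.mkClass i σ hσ) = R.mkClass k τ hτ) : σ ≤ τ.comap (realExt f.hom) := by
  intro y hy
  obtain ⟨κ, hκ, hyκ⟩ := exists_face_mem_coneRelInterior hy
  have hκ' := (S.isQuasiFan i i).face_mem _ hσ _ hκ
  have h1 := f.mono _ _ (QuasiFanSystem.mkClass_le_mkClass hκ' hσ hκ)
  rw [h] at h1
  obtain ⟨e, he, h2, hf⟩ := QuasiFanSystem.exists_of_le_mkClass h1
  exact hf.le (f.image_relInterior i κ hκ' k e he h2 ⟨y, hyκ, rfl⟩).1

end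

/-! ### Adaptedness is preserved by the algorithm. -/

section

variable {N M M' I J : Type*} [AddCommGroup N] [AddCommGroup M] [AddCommGroup M']

/-- For σ in Σ_ij the class [σ, i] = [σ, j] is below both top classes, so its image has a
representative at m i and one at m j; these are one and the same cone. -/
theorem QuasiFanMap.isAdapted {S : AffineQuasiFanSystem N I} {R : QuasiFanSystem M' J}
    (f : QuasiFanMap S.toQuasiFanSystem R) {m : I → J} {ω : I → PointedCone ℝ (ℝ ⊗[ℤ] M')}
    (hω : ∀ i, ω i ∈ R.fan (m i) (m i))
    (h : ∀ i, f.onClasses (S.mkClass i (S.cone i) (S.cone_mem i)) = R.mkClass (m i) (ω i) (hω i)) :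
    IsAdapted R f.hom m ω S.fan := by
  intro i j σ hσ
  have hi := S.fan_subset_left i j hσ
  have hj := S.fan_subset_right i j hσ
  have h1 := f.mono _ _
    (QuasiFanSystem.mkClass_le_mkClass hi (S.cone_mem i) (S.isFaceOf_left hσ))
  have h2 := f.mono _ _
    (QuasiFanSystem.mkClass_le_mkClass hj (S.cone_mem j) (S.isFaceOf_right hσ))
  rw [h] at h1 h2
  obtain ⟨e, he, h3, hf⟩ := QuasiFanSystem.exists_of_le_mkClass h1
  obtain ⟨e', he', h4, hf'⟩ := QuasiFanSystem.exists_of_le_mkClass h2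
  have h5 : S.mkClass i σ hi = S.mkClass j σ hj := QuasiFanSystem.mkClass_eq_iff.2 ⟨rfl, hσ⟩
  rw [← h5, h3] at h4
  obtain ⟨rfl, h6⟩ := QuasiFanSystem.mkClass_eq_iff.1 h4
  exact ⟨e, h6, hf, hf', f.le_comap hi he h3⟩

variable {R : QuasiFanSystem M' J} {F : M →+ M'} {m : I → J}
  {ω : I → PointedCone ℝ (ℝ ⊗[ℤ] M')} {G : Set (ℝ ⊗[ℤ] M)}

theorem IsAdapted.init {S : AffineQuasiFanSystem N I} {L : AddSubgroup N} {F : N ⧸ L →+ M'}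
    (h : IsAdapted R (F.comp (QuotientAddGroup.mk' L)) m ω S.fan) :
    IsAdapted R F m ω (ConeData.init S L).cones := by
  rintro i j ρ ⟨μ, hμ, hρ⟩
  obtain ⟨ω', h1, h2, h3, hle⟩ := h i j μ hμ.1
  refine ⟨ω', h1, h2, h3, fun x hx => ?_⟩
  obtain ⟨y, hy, rfl⟩ := hρ.le hx
  have := hle hy
  rwa [PointedCone.mem_comap, realExt_comp_apply] at this

theorem IsAdapted.enlarge {s : ConeData M I} (h : IsAdapted R F m ω s.cones)
    (hω : ∀ i, ω i ∈ R.fan (m i) (m i)) (hs : s.IsAdmissible G) (hG : G.Finite) {i j : I}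
    {ρ κ : PointedCone ℝ (ℝ ⊗[ℤ] M)} (hv : s.Violates i j ρ) (hκ : s.IsEnvelopingFace i ρ κ) :
    IsAdapted R F m ω (s.enlarge i j ρ κ).cones := by
  have hij := hs.ne_of_violates hv
  have htau : ∀ a, s.tau a ≤ (ω a).comap (realExt F) := by
    intro a
    obtain ⟨ω', -, hf, -, hle⟩ := h a a (s.tau a)
      (by rw [hs.self]; exact PointedCone.IsFaceOf.refl _)
    exact hle.trans (Submodule.comap_mono hf.le)
  obtain ⟨ω', hω', hi, hj, hle⟩ := h i j ρ hv.1.1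
  -- The preimage of ω' is a face of the preimage of ω i, which contains τ(i). It contains an
  -- interior point of κ, hence all of κ: the enlargement is forced.
  have hκω : κ ≤ ω'.comap (realExt F) := by
    obtain ⟨x, hx⟩ := (hs.cones_gen i j ρ hv.1.1).nonempty hG
    exact (hi.comap (realExt F)).le_of_mem_coneRelInterior (hκ.1.le.trans (htau i)) (hκ.2 hx)
      (hle hx.1)
  refine ConeData.enlarge_cones_induction (ρ := ρ) (κ := κ) (s := s) hij ?_ ?_ ?_ ?_
  · rw [ConeData.enlarge_cones_self]
    refine fun α hα => ⟨ω j, hω j, PointedCone.IsFaceOf.refl _, PointedCone.IsFaceOf.refl _, ?_⟩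
    exact hα.le.trans (sup_le (htau j) (hκω.trans (Submodule.comap_mono hj.le)))
  · rw [ConeData.enlarge_cones_left ρ κ hij]
    rintro α (hα | hα)
    exacts [h i j α hα.1, ⟨ω', hω', hi, hj, hα.le.trans hκω⟩]
  · rw [ConeData.enlarge_cones_right ρ κ hij]
    rintro α (hα | hα)
    exacts [h j i α hα.1, ⟨ω', by rw [R.symm]; exact hω', hj, hi, hα.le.trans hκω⟩]
  · intro a b hab
    rw [hab]; exact h a b

theorem IsAdapted.glue {s : ConeData M I} (h : IsAdapted R F m ω s.cones)
    (hs : s.IsFaceAdmissible G) {i j k : I} {ρ : PointedCone ℝ (ℝ ⊗[ℤ] M)}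
    (hv : s.NotTransitive i j k ρ) : IsAdapted R F m ω (s.glue i k ρ).cones := by
  obtain ⟨ω₁, h₁, hi, hj, hle₁⟩ := h i j ρ hv.1.1
  obtain ⟨ω₂, h₂, hj', hk, hle₂⟩ := h j k ρ hv.1.2
  -- Both cones are faces of ω j, so their intersection is a face of each and lies in both
  -- quasi-fans; transitivity in R then applies.
  have hf := hj.inf_left hj'
  have hf₁ := (hf.isFaceOf_iff_le hj).2 inf_le_left
  have hf₂ := (hf.isFaceOf_iff_le hj').2 inf_le_right
  have hmem : ω₁ ⊓ ω₂ ∈ R.fan (m i) (m k) := R.trans _ _ _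
    ⟨(R.isQuasiFan _ _).face_mem _ h₁ _ hf₁, (R.isQuasiFan _ _).face_mem _ h₂ _ hf₂⟩
  have hle : ρ ≤ (ω₁ ⊓ ω₂).comap (realExt F) := fun x hx => ⟨hle₁ hx, hle₂ hx⟩
  intro a b α hα
  rw [ConeData.glue_cones hs.toIsAdmissible] at hα
  rcases hα with hα | ⟨⟨rfl, rfl⟩ | ⟨rfl, rfl⟩, hα⟩
  · exact h a b α hα
  · exact ⟨_, hmem, hf₁.trans hi, hf₂.trans hk, hα.le.trans hle⟩
  · exact ⟨_, by rw [R.symm]; exact hmem, hf₂.trans hk, hf₁.trans hi, hα.le.trans hle⟩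

theorem IsAdapted.step {c c' : AlgConfig M I} (h : IsAdapted R F m ω c.data.cones)
    (hω : ∀ i, ω i ∈ R.fan (m i) (m i)) (hc : c.IsAdmissible G) (hG : G.Finite)
    (hstep : AlgStep c c') : IsAdapted R F m ω c'.data.cones := by
  cases hstep with
  | enlarge s i j ρ κ hv hκ => exact IsAdapted.enlarge h hω hc hG hv hκ
  | leave1 s _ => exact h
  | glue s i j k ρ hv => exact IsAdapted.glue h hc hv
  | leave2 s _ => exact h

theorem AlgReaches.isAdapted [Finite I] {S : AffineQuasiFanSystem N I} {L : AddSubgroup N}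
    {F : N ⧸ L →+ M'} (h : IsAdapted R (F.comp (QuotientAddGroup.mk' L)) m ω S.fan)
    (hω : ∀ i, ω i ∈ R.fan (m i) (m i)) {c : AlgConfig (N ⧸ L) I} (hr : AlgReaches S L c) :
    IsAdapted R F m ω c.data.cones := by
  obtain ⟨A, hA, hgen⟩ := S.exists_generators
  induction hr with
  | refl => exact h.init
  | tail hr hstep ih =>
    exact ih.step hω (AlgReaches.isAdmissible (hA.image _) hgen hr) ((hA.image _).image _) hstep

/-- The affine system of quasi-fans given by an output of the algorithm. -/
def ConeData.IsFaceAdmissible.toAffineQuasiFanSystem {s : ConeData M I}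
    (hs : s.IsFaceAdmissible G) (hG : G.Finite) (hlat : ∀ σ, IsGeneratedIn G σ → IsLatticeCone σ)
    (ht : ∀ i j k ρ, ¬ s.NotTransitive i j k ρ) : AffineQuasiFanSystem M I where
  fan := s.cones
  isQuasiFan i j :=
    { finite := hs.finite hG i j
      nonempty := hs.nonempty i j
      isLatticeCone := fun σ hσ => hlat σ (hs.cones_gen i j σ hσ)
      face_mem := hs.face_mem i j
      inf_isFaceOf := fun σ hσ τ hτ => by
        have h1 := hs.isFaceOf i j σ hσ
        have h2 := hs.isFaceOf i j τ hτ
        have h3 := h1.inf_left h2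
        exact ⟨(h3.isFaceOf_iff_le h1).2 inf_le_left, (h3.isFaceOf_iff_le h2).2 inf_le_right⟩ }
  symm := hs.symm
  trans i j k ρ hρ := by_contra fun h => ht i j k ρ ⟨hρ, h⟩
  cone := s.tau
  fan_self := hs.self

end

/-! ### The quotient lattice and the main theorem. -/

theorem AddSubgroup.finite_quotient {N : Type*} [AddCommGroup N] [Module.Finite ℤ N]
    (L : AddSubgroup N) : Module.Finite ℤ (N ⧸ L) :=
  Module.Finite.of_surjective (QuotientAddGroup.mk' L).toIntLinearMap
    (QuotientAddGroup.mk'_surjective L)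

theorem AddSubgroup.free_quotient_of_nsmulSaturated {N : Type*} [AddCommGroup N]
    [Module.Finite ℤ N] {L : AddSubgroup N} (hL : L.toAddSubmonoid.NSMulSaturated) :
    Module.Free ℤ (N ⧸ L) := by
  have := AddSubgroup.finite_quotient L
  have : Module.IsTorsionFree ℤ (N ⧸ L) := by
    rw [Module.isTorsionFree_int_iff_isAddTorsionFree]
    refine ⟨fun n hn x y hxy => ?_⟩
    obtain ⟨x, rfl⟩ := QuotientAddGroup.mk_surjective x
    obtain ⟨y, rfl⟩ := QuotientAddGroup.mk_surjective y
    have h : n • (-x + y) ∈ L := by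
      rw [← QuotientAddGroup.eq_zero_iff]
      simpa [smul_add, neg_add_eq_zero] using hxy
    exact QuotientAddGroup.eq.2 ((hL h).resolve_left hn)
  infer_instance

theorem mainTheorem2 {N : Type u} [AddCommGroup N] [Module.Free ℤ N]
    [Module.Finite ℤ N] {I : Type v} [Finite I] (S : AffineQuasiFanSystem N I)
    (L : AddSubgroup N) (hL : L.toAddSubmonoid.NSMulSaturated) :
    -- every reachable configuration consists of finitely many rational polyhedral cones
    (∀ c : AlgConfig (N ⧸ L) I, AlgReaches S L c →
      ∀ i, IsLatticeCone (c.data.tau i) ∧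
        ∀ j, (c.data.cones i j).Finite ∧ ∀ τ ∈ c.data.cones i j, IsLatticeCone τ) ∧
    -- the face used in Loop 1 exists and is unique
    (∀ (s : ConeData (N ⧸ L) I) i j ρ, AlgReaches S L (.loop1 s) → s.Violates i j ρ →
      ∃! κ, s.IsEnvelopingFace i ρ κ) ∧
    -- the algorithm never gets stuck before it yields an output
    (∀ c : AlgConfig (N ⧸ L) I, AlgReaches S L c → (∀ s, c ≠ .output s) → ∃ c', AlgStep c c') ∧
    -- there is no infinite run
    (¬ ∃ r : ℕ → AlgConfig (N ⧸ L) I, r 0 = .loop1 (ConeData.init S L) ∧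
      ∀ n, AlgStep (r n) (r (n + 1))) ∧
    -- every output is an affine system of quasi-fans, and the induced map is the prequotient
    (∀ s : ConeData (N ⧸ L) I, AlgReaches S L (.output s) →
      ∃ T : AffineQuasiFanSystem (N ⧸ L) I, T.cone = s.tau ∧ T.fan = s.cones ∧
        (∀ i j, ∀ σ ∈ S.fan i j, ∃ τ ∈ T.fan i j,
          σ.map (realExt (QuotientAddGroup.mk' L)) ≤ τ) ∧
        ∃ p : QuasiFanMap S.toQuasiFanSystem T.toQuasiFanSystem,
          IsIndexProjection p ∧
          (∀ q : QuasiFanMap S.toQuasiFanSystem T.toQuasiFanSystem,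
            IsIndexProjection q → q = p) ∧
          IsPrequotient.{w, w'} L p) := by
  obtain ⟨A, hA, hgen⟩ := S.exists_generators
  have hG := (hA.image (fun n : N => (1 : ℝ) ⊗ₜ[ℤ] n)).image (realExt (QuotientAddGroup.mk' L))
  have hadm : ∀ {c : AlgConfig (N ⧸ L) I}, AlgReaches S L c → c.IsAdmissible _ := fun h =>
    AlgReaches.isAdmissible (hA.image _) hgen h
  have hlat : ∀ σ, IsGeneratedIn (realExt (QuotientAddGroup.mk' L) ''
      ((fun n : N => (1 : ℝ) ⊗ₜ[ℤ] n) '' A)) σ → IsLatticeCone σ := fun σ hσ => by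
    rw [image_realExt_image_tmul] at hσ
    exact isLatticeCone_iff.2 ⟨_, hA.image _, hσ⟩
  refine ⟨fun c hc i => ?_, fun s i j ρ hs h => ?_, fun c hc h => (hadm hc).exists_step hG h,
    ?_, fun s hs => ?_⟩
  · have h := (hadm hc).isAdmissible_data
    exact ⟨hlat _ (h.tau_gen i), fun j => ⟨h.finite hG i j, fun τ hτ =>
      hlat _ (h.cones_gen i j τ hτ)⟩⟩
  · exact ConeData.IsAdmissible.existsUnique_isEnvelopingFace (hadm hs) hG h.1.1
  · rintro ⟨r, h0, hstep⟩
    have := Fintype.ofFinite I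
    have hr : ∀ n, AlgReaches S L (r n) := by
      intro n
      induction n with
      | zero => rw [h0]; exact Relation.ReflTransGen.refl
      | succ n ih => exact ih.tail (hstep n)
    obtain ⟨n, hn⟩ := WellFounded.not_rel_apply_succ (r := (· < ·))
      (fun n => (r n).weight (realExt (QuotientAddGroup.mk' L) ''
        ((fun n : N => (1 : ℝ) ⊗ₜ[ℤ] n) '' A)))
    exact hn ((hadm (hr n)).weight_lt hG (hstep n))
  · obtain ⟨hface, ht⟩ := hadm hs
    have hcov := hs.covers
    let T := hface.toAffineQuasiFanSystem hG hlat ht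
    -- The map 𝔭 is itself an instance of the extension principle, with the τ(i) as bounding cones.
    have hadapt : IsAdapted T.toQuasiFanSystem (QuotientAddGroup.mk' L) id T.cone S.fan := by
      intro i j σ hσ
      obtain ⟨τ, hτ, hle⟩ := hcov.cover i j σ hσ
      exact ⟨τ, hτ, T.isFaceOf_left hτ, T.isFaceOf_right hτ, Submodule.map_le_iff_le_comap.1 hle⟩
    obtain ⟨p, hp, hple⟩ := hadapt.exists_map T.cone_mem
    refine ⟨T, rfl, rfl, hcov.cover, p, ⟨hp, hple⟩, fun q hq =>
      QuasiFanMap.eq_of_le (hq.1.trans hp.symm) T.cone_mem hq.2 hple, ?_⟩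
    have hptop : ∀ i, p.onClasses (S.mkClass i (S.cone i) (S.cone_mem i)) =
        T.mkClass i (T.cone i) (T.cone_mem i) := by
      intro i
      obtain ⟨e, he, h1, hf⟩ := QuasiFanSystem.exists_of_le_mkClass (hple i _ (S.cone_mem i))
      have hi := p.image_relInterior i _ (S.cone_mem i) _ e he h1
      rw [hp] at hi
      obtain rfl := eq_of_image_subset (S.coneRelInterior_nonempty (S.cone_mem i)) hf
        (PointedCone.IsFaceOf.refl _) hi (hcov.relInterior i)
      exact h1
    refine ⟨AddSubgroup.free_quotient_of_nsmulSaturated hL, L.finite_quotient, inferInstance, ?_, ?_⟩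
    · rw [hp, QuotientAddGroup.ker_mk']
    · intro M J _ _ _ _ R f hf
      -- The images of the top classes [σ(i), i] under the test map serve as bounds for the
      -- factorization.
      choose m ω hω hfω using fun i => QuasiFanSystem.exists_mkClass
        (f.onClasses (S.mkClass i (S.cone i) (S.cone_mem i)))
      let F : N ⧸ L →+ M := QuotientAddGroup.lift L f.hom hf
      have hF : F.comp (QuotientAddGroup.mk' L) = f.hom := by ext; rfl
      have hfad := f.isAdapted hω fun i => (hfω i).symm
      rw [← hF] at hfad
      have hTad : IsAdapted R.toQuasiFanSystem F m ω T.fan := hs.isAdapted hfad hω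
      obtain ⟨g, hg, hgle⟩ := hTad.exists_map hω
      refine ⟨g, ?_, fun g' hg' => ?_⟩
      · refine QuasiFanMap.eq_of_le (m := m) (ω := ω) ?_ hω (fun i σ hσ => ?_) fun i σ hσ => ?_
        · change f.hom = g.hom.comp p.hom
          rw [hg, hp, hF]
        · rw [hfω i]
          exact f.mono _ _ (QuasiFanSystem.mkClass_le_mkClass hσ _ (S.isFaceOf_left hσ))
        · exact (g.mono _ _ (hple i σ hσ)).trans (hgle i _ _)
      · refine QuasiFanMap.eq_of_le (m := m) (ω := ω) ?_ hω (fun i σ hσ => ?_) hgle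
        · rw [hg]
          refine QuotientAddGroup.addMonoidHom_ext _ ?_
          rw [hF, hg', ← hp]
          rfl
        -- Any factorization sends [τ(i), i] = 𝔭([σ(i), i]) to the bound [ω i, m i], so by
        -- monotonicity it satisfies the bounds that determine g.
        · have h1 := g'.mono _ _
            (QuasiFanSystem.mkClass_le_mkClass hσ (T.cone_mem i) (T.isFaceOf_left hσ))
          rw [← hptop i] at h1
          rw [hfω i, hg']
          exact h1
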